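/- **Theorem (time-independent combinatorial Mori–Zwanzig equation).** Let $X$ be a real or complex Banach space and let $\mathcal P,\mathcal Q$ be bounded operators on $X$ with $\mathcal P+\mathcal Q=\mathcal I$ and $\mathcal P\mathcal Q=0$. Let $\mathcal L$ be a (possibly unbounded) linear operator in $X$ such that the closures of $\mathcal L$ and of $\mathcal Q\mathcal L$ generate strongly continuous semigroups $e^{t\mathcal L}$ and $e^{t\mathcal Q\mathcal L}$, $t\ge 0$; write $\mathcal L$ also for its closure. Assume that the semigroups are differentiable in time to any order where they are used, i.e. $\mathrm{Ran}(\mathcal P)\subset\bigcap_n D(\mathcal L^n)$, $e^{s\mathcal Q\mathcal L}\mathcal Q\mathcal L\mathcal Px\in D(\mathcal L)$ for all $s\ge 0$, $x\in X$, and $s\mapsto \mathcal K(s)x:=\mathcal P\mathcal Le^{s\mathcal Q\mathcal L}\mathcal Q\mathcal L\mathcal Px$ is $C^\infty$ on $[0,\infty)$ for every $x\in X$. Let $V\subset X$ be a subspace with $\mathrm{Ran}(\mathcal P)\subset V$ such that $\mathcal P\mathcal L\mathcal P|_V:V\to V$ is invertible, and put $a_j=\mathcal P\mathcal L^j\mathcal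 P|_V$ for $j\ge1$. *Polynomials.* In noncommuting letters let $\tilde P_0=1$ and $\tilde P_n=b_n-\sum_{k=1}^{n-1}b_{n-k}\tilde P_k$ for $n\ge1$ (noncommutative bipartition polynomials), and let $$\hat B_{n,k}=\sum_{\substack{j_1,\dots,j_k\ge1\\ j_1+\cdots+j_k=n}}\frac1{k!}\,\frac{n!}{j_1!\cdots j_k!}\,a_{j_1}a_{j_2}\cdots a_{j_k}$$ (Type-II noncommutative partial Bell polynomials). Below both are evaluated at $b_j=a_j=\mathcal P\mathcal L^j\mathcal P|_V$. *Conclusions.* 1. For $t\ge0$, applied to any $x\in X$, $\ \frac{d}{dt}\mathcal Pe^{t\mathcal L}\mathcal P=\mathcal Pe^{t\mathcal L}\mathcal P\mathcal L\mathcal P+\int_0^t\mathcal Pe^{(t-s)\mathcal L}\mathcal K(s)\,ds$. 2. The system $\mathcal F_0=\tilde P_2$, $\ \tilde P_{n+2}=\sum_{k=1}^n\mathcal F_k\hat B_{n,k}$ $(n\ge1)$ has exactly one solution $(\mathcal F_n)_{n\ge0}$ in the linear operators on $V$. It is given recursively by $$\mathcal F_0=\mathcal P\mathcal L^2\mathcal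 P-(\mathcal P\mathcal L\mathcal P)^2,\qquad \mathcal F_n=\tilde P_{n+2}\,(\mathcal P\mathcal L\mathcal P|_V)^{-n}-\sum_{k=1}^{n-1}\mathcal F_k\hat B_{n,k}\,(\mathcal P\mathcal L\mathcal P|_V)^{-n}\quad(n\ge1),$$ so each $\mathcal F_n$ is a polynomial in $(\mathcal P\mathcal L\mathcal P|_V)^{-1}$ and the operators $a_j$, $j\ge1$. 3. With these $\mathcal F_n$, the combinatorial expansion $$\frac{d}{dt}\mathcal Pe^{t\mathcal L}\mathcal P=\mathcal Pe^{t\mathcal L}\mathcal P\mathcal L\mathcal P+\sum_{n=0}^\infty\sum_{k=0}^n\frac{(-1)^{n-k}}{(n-k)!\,k!}\int_0^t\mathcal Pe^{(t-s)\mathcal L}\mathcal F_n(\mathcal Pe^{s\mathcal L}\mathcal P)^k\,ds$$ (where $\mathcal F_n(\mathcal Pe^{s\mathcal L}\mathcal P)^k$ acts after $\mathcal P$) holds in the following sense. (a) It holds to all orders in time: for every $x\in X$ and $N\ge 0$, the difference between the left side and the right side with the sum over $n$ cut off at $n\le N$, applied to $x$, is $O(t^{N+2})$ as $t\to0^+$;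 likewise $\mathcal K(s)x=\sum_{n=0}^N\frac1{n!}\mathcal F_n(\mathcal Pe^{s\mathcal L}\mathcal P-\mathcal P)^n\mathcal Px+O(s^{N+1})$ as $s\to0^+$. (b) If $s\mapsto\mathcal Pe^{s\mathcal L}\mathcal P$ and $s\mapsto\mathcal K(s)$ are real analytic in operator norm on some $[0,\delta)$, $\delta>0$, then there is $\tau\in(0,\delta]$ such that for all $t\in[0,\tau)$ and $x\in X$ the series over $n$, applied to $x$, converges and the expansion is an identity. (c) If these two functions are real analytic in operator norm on $[0,\tau)$ and there are $r<\rho$ with $\|\mathcal Pe^{s\mathcal L}\mathcal Pv-v\|\le r\|v\|$ for all $s\in[0,\tau)$, $v\in V$, and constants $c_n$ with $\|\mathcal F_nv\|\le c_n\|v\|$ for $v\in V$ and $\sum_nc_n\rho^n/n!$ convergent, then the same is true for all $t\in[0,\tau)$. -/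

import Mathlib

open Set Filter Topology
open scoped Nat ContDiff

noncomputable section

namespace CMZE

/-! ### Noncommutative polynomials

Polynomials are elements of the free unital associative algebra on letters `x_0, x_1, x_2, …`; only
the letters of index `≥ 1` occur. -/

/-- The letter `x_j` of the alphabet. -/
def letter (𝕜 : Type*) [Field 𝕜] (j : ℕ) : FreeAlgebra 𝕜 ℕ := FreeAlgebra.ι 𝕜 j

/-- Noncommutative bipartition polynomials: `P̃_0 = 1` and, for `n ≥ 1`,
`P̃_n = ∑_{k=0}^{n-1} (-1)^{δ_{k0}+1} b_{n-k} P̃_k` (so `P̃_1 = b_1`). -/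
def bipartitionPoly (𝕜 : Type*) [Field 𝕜] : ℕ → FreeAlgebra 𝕜 ℕ
  | 0 => 1
  | n + 1 => ∑ k : Fin (n + 1),
      ((-1 : 𝕜) ^ ((if (k : ℕ) = 0 then 1 else 0) + 1)) •
        (letter 𝕜 (n + 1 - (k : ℕ)) * bipartitionPoly 𝕜 (k : ℕ))
  termination_by n => n
  decreasing_by exact k.2

/-- Type-II noncommutative partial Bell polynomials: `B̂_{n,k}` is the sum, over all words
`a_{j_1} a_{j_2} ⋯ a_{j_k}` with all `j_i ≥ 1` and `j_1 + ⋯ + j_k = n`, of the word with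
coefficient `(1 / k!) * n! / (j_1! ⋯ j_k!)`. -/
def bellPolyII (𝕜 : Type*) [Field 𝕜] (n k : ℕ) : FreeAlgebra 𝕜 ℕ :=
  ∑ j ∈ (Finset.Nat.antidiagonalTuple k n).filter (fun j => ∀ i, 1 ≤ j i),
    ((1 / (k ! : 𝕜)) * ((n ! : 𝕜) / ∏ i, ((j i)! : 𝕜))) •
      (List.ofFn (fun i => letter 𝕜 (j i))).prod

/-- Substitution of the elements `a j` of an algebra for the letters. -/
def evalAt {𝕜 R : Type*} [Field 𝕜] [Ring R] [Algebra 𝕜 R] (a : ℕ → R) :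
    FreeAlgebra 𝕜 ℕ →ₐ[𝕜] R :=
  FreeAlgebra.lift 𝕜 a

/-! ### Semigroups and unbounded operators -/

section Operators

variable {𝕜 X : Type*} [RCLike 𝕜] [NormedAddCommGroup X] [NormedSpace 𝕜 X]

/-- Strongly continuous one-parameter semigroups `(T t)_{t ≥ 0}` of bounded operators; the values
at negative times are irrelevant. -/
structure IsC0Semigroup (T : ℝ → X →L[𝕜] X) : Prop where
  map_zero : T 0 = 1
  map_add : ∀ s t : ℝ, 0 ≤ s → 0 ≤ t → T (s + t) = T s * T t
  continuousOn : ∀ x : X, ContinuousOn (fun t => T t x) (Ici 0)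

/-- `A` is the infinitesimal generator of `T`: the domain of `A` is the set of `x` at which
`(T h x - x) / h` converges as `h → 0+`, and `A x` is the limit. -/
def IsGenerator [NormedSpace ℝ X] (A : X →ₗ.[𝕜] X) (T : ℝ → X →L[𝕜] X) : Prop :=
  ∀ x y : X, (x, y) ∈ A.graph ↔ Tendsto (fun h : ℝ => h⁻¹ • (T h x - x)) (𝓝[>] 0) (𝓝 y)

/-- The closure of the operator `A` generates the strongly continuous semigroup `T`. -/
structure ClosureGenerates [NormedSpace ℝ X] (A : X →ₗ.[𝕜] X) (T : ℝ → X →L[𝕜] X) : Prop where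
  isClosable : A.IsClosable
  isSemigroup : IsC0Semigroup T
  isGenerator : IsGenerator A.closure T

/-- The operator `B A`, with the domain of `A`, for an everywhere defined bounded `B`. -/
def leftComp (B : X →L[𝕜] X) (A : X →ₗ.[𝕜] X) : X →ₗ.[𝕜] X :=
  (B : X →ₗ[𝕜] X).compPMap A

/-- `A x` for `x` in the domain of `A` (and `0` elsewhere). -/
def totalApply (A : X →ₗ.[𝕜] X) (x : X) : X :=
  open Classical in if h : x ∈ A.domain then A ⟨x, h⟩ else 0

/-- The domain of `A ^ n`. -/
def powDomain (A : X →ₗ.[𝕜] X) : ℕ → Submodule 𝕜 X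
  | 0 => ⊤
  | n + 1 => ((powDomain A n).comap A.toFun).map A.domain.subtype

/-- The intersection of the domains of all the powers of `A`. -/
def smoothDomain (A : X →ₗ.[𝕜] X) : Submodule 𝕜 X := ⨅ n, powDomain A n

theorem mem_powDomain_succ (A : X →ₗ.[𝕜] X) (n : ℕ) (x : X) :
    x ∈ powDomain A (n + 1) ↔ ∃ h : x ∈ A.domain, A ⟨x, h⟩ ∈ powDomain A n := by
  simp only [powDomain, Submodule.mem_map, Submodule.mem_comap]
  constructor
  · rintro ⟨y, hy, rfl⟩
    exact ⟨y.2, hy⟩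
  · rintro ⟨h, hx⟩
    exact ⟨⟨x, h⟩, hx, rfl⟩

theorem smoothDomain_le (A : X →ₗ.[𝕜] X) : smoothDomain A ≤ A.domain := fun x hx =>
  ((mem_powDomain_succ A 0 x).1 ((Submodule.mem_iInf _).1 hx 1)).1

theorem apply_mem_smoothDomain (A : X →ₗ.[𝕜] X) (x : X) (hx : x ∈ smoothDomain A) :
    A ⟨x, smoothDomain_le A hx⟩ ∈ smoothDomain A :=
  (Submodule.mem_iInf _).2 fun n =>
    ((mem_powDomain_succ A n x).1 ((Submodule.mem_iInf _).1 hx (n + 1))).2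

/-- The restriction of `A` to the intersection of the domains of its powers, which it maps to
itself. -/
def smoothEnd (A : X →ₗ.[𝕜] X) : Module.End 𝕜 (smoothDomain A) :=
  (A.toFun.comp (Submodule.inclusion (smoothDomain_le A))).codRestrict (smoothDomain A)
    (fun x => apply_mem_smoothDomain A x x.2)

/-- The everywhere defined operator `A ^ j P`, when the range of `P` lies in the domain of every
power of `A`. -/
def powProj (A : X →ₗ.[𝕜] X) (P : X →L[𝕜] X)
    (hP : LinearMap.range (P : X →ₗ[𝕜] X) ≤ smoothDomain A) (j : ℕ) : X →ₗ[𝕜] X :=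
  (smoothDomain A).subtype ∘ₗ (smoothEnd A ^ j) ∘ₗ
    (P : X →ₗ[𝕜] X).codRestrict (smoothDomain A) (fun x => hP ⟨x, rfl⟩)

/-- The restriction `(P M)|_V : V → V`, for a subspace `V` containing the range of `P`. -/
def projOn (P : X →L[𝕜] X) (V : Submodule 𝕜 X)
    (hV : LinearMap.range (P : X →ₗ[𝕜] X) ≤ V) (M : X →ₗ[𝕜] X) : Module.End 𝕜 V :=
  ((P : X →ₗ[𝕜] X) ∘ₗ M).restrict (fun x _ => hV ⟨M x, rfl⟩)

/-- The operators `(P A^j P)|_V : V → V`. -/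
def moment (A : X →ₗ.[𝕜] X) (P : X →L[𝕜] X)
    (hP : LinearMap.range (P : X →ₗ[𝕜] X) ≤ smoothDomain A) (V : Submodule 𝕜 X)
    (hV : LinearMap.range (P : X →ₗ[𝕜] X) ≤ V) (j : ℕ) : Module.End 𝕜 V :=
  projOn P V hV (powProj A P hP j)

/-- The operator `(P e^{sL} P)|_V : V → V`, where `T s = e^{sL}`. -/
def projEvolution (T : ℝ → X →L[𝕜] X) (P : X →L[𝕜] X) (V : Submodule 𝕜 X)
    (hV : LinearMap.range (P : X →ₗ[𝕜] X) ≤ V) (s : ℝ) : Module.End 𝕜 V :=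
  projOn P V hV ((T s : X →ₗ[𝕜] X) ∘ₗ (P : X →ₗ[𝕜] X))

/-- `P x` as an element of `V`. -/
def projVec (P : X →L[𝕜] X) (V : Submodule 𝕜 X)
    (hV : LinearMap.range (P : X →ₗ[𝕜] X) ≤ V) (x : X) : V := ⟨P x, hV ⟨x, rfl⟩⟩

/-- The memory kernel `P A e^{sQA} Q A P x`, where `S s = e^{sQA}`. -/
def memoryKernel (A : X →ₗ.[𝕜] X) (P Q : X →L[𝕜] X)
    (hP : LinearMap.range (P : X →ₗ[𝕜] X) ≤ smoothDomain A) (S : ℝ → X →L[𝕜] X)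
    (s : ℝ) (x : X) : X :=
  P (totalApply A (S s (Q (powProj A P hP 1 x))))

/-- The system of operator equations in `V` for the unknowns `F_0, F_1, …`:
`P̃_2 = F_0`, and `P̃_{n+2} = ∑_{k=1}^n F_k B̂_{n,k}` for `n ≥ 1`, all polynomials being evaluated
at `a_j = (P A^j P)|_V`. -/
def SolvesWordEquation {R : Type*} [Ring R] [Algebra 𝕜 R] (a F : ℕ → R) : Prop :=
  F 0 = evalAt a (bipartitionPoly 𝕜 2) ∧
  ∀ n : ℕ, 1 ≤ n → evalAt a (bipartitionPoly 𝕜 (n + 2)) =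
    ∑ k ∈ Finset.Icc 1 n, F k * evalAt a (bellPolyII 𝕜 n k)

/-- The integrand `P e^{(t-s)L} F_n (P e^{sL} P)^k P x`. -/
def termIntegrand (T : ℝ → X →L[𝕜] X) (P : X →L[𝕜] X) (V : Submodule 𝕜 X)
    (hV : LinearMap.range (P : X →ₗ[𝕜] X) ≤ V) (F : ℕ → Module.End 𝕜 V)
    (n k : ℕ) (t : ℝ) (x : X) (s : ℝ) : X :=
  P (T (t - s) ((F n ((projEvolution T P V hV s ^ k) (projVec P V hV x)) : V) : X))

/-- The `n`-th memory term
`∑_{k=0}^n (-1)^{n-k} / ((n-k)! k!) ∫_0^t P e^{(t-s)L} F_n (P e^{sL} P)^k P x ds`. -/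
def memoryTerm [NormedSpace ℝ X] (T : ℝ → X →L[𝕜] X) (P : X →L[𝕜] X) (V : Submodule 𝕜 X)
    (hV : LinearMap.range (P : X →ₗ[𝕜] X) ≤ V) (F : ℕ → Module.End 𝕜 V)
    (n : ℕ) (t : ℝ) (x : X) : X :=
  ∑ k ∈ Finset.range (n + 1), ((-1 : 𝕜) ^ (n - k) / (((n - k)! : 𝕜) * (k ! : 𝕜))) •
    ∫ s in (0 : ℝ)..t, termIntegrand T P V hV F n k t x s

end Operators

end CMZE

end

/-! Write `E(s)` for `P e^{sL} P` on `V`, and `A(X) = ∑_{n ≥ 1} a_n X^n / n!`. Everything rests on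
two generating-function facts. First, `E(s) - 1` has the expansion `A(s)` at `0+`, and `k! / n!`
times the Bell polynomial `B̂_{n,k}` is the `n`-th coefficient of `A^k`. Second, `K(s)` has the
Taylor coefficients `P̃_{n+2} / n!`. The operator equations for `F` therefore say that `K = ∑ (F_n /
n!) (E - 1)^n` as formal series. Since `A = X U` with `U(0) = a_1` invertible, the system is
triangular and has one solution. The binomial theorem turns `(F_n / n!) (E - 1)^n` into the double
sum.

The Taylor coefficients of `K` come from Dyson's identity. Variation of constants compares `e^{tL}`
with `e^{tQL}` on `QLPx`, and `P` annihilates the orthogonal orbit, so `P e^{tL} QLPx` is the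
convolution of `P e^{tL}` with `K`. Matching one-sided expansions (`HasExpansion`) gives a
unitriangular recursion, which is that of the bipartition polynomials (`hasExpansion_kernelOn`).

For convergence, `F_n / n!` must grow at most geometrically. A residue computation in the spirit of
Lagrange inversion does this (`coeff_mul_pow_succ_of_eq_sum`): multiplication by `U^{-(m+1)}` turns
the system into a convolution recursion with geometric data. Then `H(y) = ∑ (F_n / n!) y^n` is
analytic near `0`, and `K(s)v - H(E(s) - 1)v` is an analytic function with zero expansion, hence
zero.

Invertibility of `a_1` also forces `V = Ran P`. So `V` is closed, and the closed graph theorem makes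
all `a_j` and the inverse bounded, although `L` is not. -/

namespace CMZE

/-! ### Generating series of the two polynomial families -/

section Algebra

open PowerSeries

theorem coeff_pow_eq_sum_antidiagonalTuple {A : Type*} [Semiring A] (f : A⟦X⟧) (k n : ℕ) :
    coeff n (f ^ k) =
      ∑ j ∈ Finset.Nat.antidiagonalTuple k n, (List.ofFn fun i => coeff (j i) f).prod := by
  induction k generalizing n with
  | zero =>
    cases n with
    | zero => simp
    | succ n => simp [coeff_one]
  | succ k ih =>
    rw [pow_succ', coeff_mul]
    simp_rw [ih, Finset.mul_sum]
    rw [Finset.sum_sigma']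
    refine Finset.sum_bij' (fun p _ => Fin.cons p.1.1 p.2)
      (fun j _ => ⟨(j 0, ∑ i, Fin.tail j i), Fin.tail j⟩) ?_ ?_ ?_ ?_ ?_
    · rintro ⟨⟨i, m⟩, j⟩ h
      simp only [Finset.mem_sigma, Finset.Nat.mem_antidiagonalTuple] at h ⊢
      rw [Fin.sum_univ_succ]
      simpa [h.2] using Finset.HasAntidiagonal.mem_antidiagonal.1 h.1
    · intro j h
      simp only [Finset.mem_sigma, Finset.Nat.mem_antidiagonalTuple] at h ⊢
      rw [Fin.sum_univ_succ] at h
      exact ⟨Finset.HasAntidiagonal.mem_antidiagonal.2 h, trivial⟩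
    · rintro ⟨⟨i, m⟩, j⟩ h
      simp only [Finset.mem_sigma, Finset.Nat.mem_antidiagonalTuple] at h
      obtain ⟨-, rfl⟩ := h
      simp
    · intro j h
      exact Fin.cons_self_tail j
    · rintro ⟨⟨i, m⟩, j⟩ h
      simp [List.ofFn_succ]

variable {𝕜 A : Type*} [Field 𝕜] [Ring A] [Algebra 𝕜 A]

theorem prod_ofFn_smul {k : ℕ} (c : Fin k → 𝕜) (x : Fin k → A) :
    (List.ofFn fun i => c i • x i).prod = (∏ i, c i) • (List.ofFn x).prod := by
  induction k with
  | zero => simp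
  | succ k ih =>
    simp only [List.ofFn_succ, List.prod_cons, ih, Fin.prod_univ_succ]
    rw [smul_mul_smul_comm]

theorem evalAt_letter (a : ℕ → A) (j : ℕ) : evalAt (𝕜 := 𝕜) a (letter 𝕜 j) = a j := by
  simp [evalAt, letter]

/-- The exponential generating series `∑_{n ≥ 1} a_n X^n / n!`. -/
noncomputable def expGen (𝕜 : Type*) {A : Type*} [Field 𝕜] [Ring A] [Algebra 𝕜 A] (a : ℕ → A) :
    A⟦X⟧ :=
  PowerSeries.mk fun n => if n = 0 then 0 else ((n ! : 𝕜)⁻¹) • a n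

theorem coeff_expGen (a : ℕ → A) (n : ℕ) :
    coeff n (expGen 𝕜 a) = if n = 0 then 0 else ((n ! : 𝕜)⁻¹) • a n := by
  simp [expGen]

/-- The condition `j_i ≥ 1` is encoded by the vanishing constant coefficient of `expGen`: a word
with some `j_i = 0` contributes a zero factor to the power. -/
theorem evalAt_bellPolyII (a : ℕ → A) (n k : ℕ) :
    evalAt a (bellPolyII 𝕜 n k) = ((n ! : 𝕜) / (k ! : 𝕜)) • coeff n (expGen 𝕜 a ^ k) := by
  rw [coeff_pow_eq_sum_antidiagonalTuple, bellPolyII, map_sum, Finset.smul_sum,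
    Finset.sum_filter]
  refine Finset.sum_congr rfl fun j _ => ?_
  split_ifs with h
  · have : (fun i => coeff (j i) (expGen 𝕜 a)) = fun i => (((j i)! : 𝕜)⁻¹) • a (j i) := by
      funext i
      rw [coeff_expGen, if_neg (Nat.one_le_iff_ne_zero.1 (h i))]
    rw [this, prod_ofFn_smul, map_smul, map_list_prod, List.map_ofFn, smul_smul]
    congr 1
    · rw [Finset.prod_inv_distrib]; ring
    · congr 2
      funext i
      exact evalAt_letter a _
  · push Not at h
    obtain ⟨i, hi⟩ := h
    rw [List.prod_eq_zero, smul_zero]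
    rw [List.mem_ofFn]
    exact ⟨i, by simp [coeff_expGen, Nat.lt_one_iff.1 hi]⟩

theorem evalAt_bipartitionPoly_zero (a : ℕ → A) : evalAt a (bipartitionPoly 𝕜 0) = 1 := by
  rw [bipartitionPoly, map_one]

/-- The defining recursion of the bipartition polynomials, as a convolution identity. -/
theorem sum_mul_evalAt_bipartitionPoly (a : ℕ → A) (h0 : a 0 = 1) (n : ℕ) :
    ∑ k ∈ Finset.range (n + 1), a (n - k) * evalAt a (bipartitionPoly 𝕜 (k + 1)) = a (n + 1) := by
  rw [Finset.sum_range_succ, Nat.sub_self, h0, one_mul, bipartitionPoly, map_sum,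
    Fin.sum_univ_succ]
  simp only [map_smul, map_mul, evalAt_letter]
  rw [Finset.sum_range (fun k => a (n - k) * evalAt a (bipartitionPoly 𝕜 (k + 1)))]
  simp [evalAt_bipartitionPoly_zero]

theorem evalAt_bipartitionPoly_two (a : ℕ → A) :
    evalAt a (bipartitionPoly 𝕜 2) = a 2 - a 1 ^ 2 := by
  have e1 : evalAt a (bipartitionPoly 𝕜 1) = a 1 := by
    rw [bipartitionPoly]
    simp [evalAt_letter, evalAt_bipartitionPoly_zero]
  rw [bipartitionPoly, map_sum, Fin.sum_univ_two]
  simp [evalAt_letter, evalAt_bipartitionPoly_zero, e1, sq, sub_eq_add_neg]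

theorem evalAt_bipartitionPoly_mem (a : ℕ → A) (s : Subalgebra 𝕜 A) (hs : ∀ j, 1 ≤ j → a j ∈ s)
    (n : ℕ) : evalAt a (bipartitionPoly 𝕜 n) ∈ s := by
  induction n using Nat.strong_induction_on with
  | _ n ih =>
    cases n with
    | zero => rw [evalAt_bipartitionPoly_zero]; exact one_mem s
    | succ n =>
      rw [bipartitionPoly, map_sum]
      refine sum_mem fun k _ => ?_
      rw [map_smul, map_mul, evalAt_letter]
      exact s.smul_mem (mul_mem (hs _ (by omega)) (ih _ k.2)) _

theorem evalAt_bellPolyII_mem (a : ℕ → A) (s : Subalgebra 𝕜 A) (hs : ∀ j, 1 ≤ j → a j ∈ s)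
    (n k : ℕ) : evalAt a (bellPolyII 𝕜 n k) ∈ s := by
  rw [bellPolyII, map_sum]
  refine sum_mem fun j hj => ?_
  rw [map_smul, map_list_prod]
  refine s.smul_mem (list_prod_mem ?_) _
  intro x hx
  simp only [List.map_ofFn, List.mem_ofFn, Function.comp_apply, evalAt_letter] at hx
  obtain ⟨i, rfl⟩ := hx
  exact hs _ ((Finset.mem_filter.1 hj).2 i)

theorem map_evalAt {B : Type*} [Ring B] [Algebra 𝕜 B] (f : A →ₐ[𝕜] B) (a : ℕ → A)
    (p : FreeAlgebra 𝕜 ℕ) : f (evalAt a p) = evalAt (fun n => f (a n)) p := by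
  have : f.comp (evalAt a) = evalAt (fun n => f (a n)) := by
    refine FreeAlgebra.hom_ext ?_
    funext j
    simp [evalAt]
  exact DFunLike.congr_fun this p

/-- The series `∑_{n ≥ 0} a_{n+1} X^n / (n+1)!`. -/
noncomputable def expGenDiv (𝕜 : Type*) {A : Type*} [Field 𝕜] [Ring A] [Algebra 𝕜 A] (a : ℕ → A) :
    A⟦X⟧ :=
  PowerSeries.mk fun n => (((n + 1)! : 𝕜)⁻¹) • a (n + 1)

theorem expGen_eq_X_mul (a : ℕ → A) : expGen 𝕜 a = X * expGenDiv 𝕜 a := by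
  ext n
  cases n with
  | zero => simp [coeff_expGen]
  | succ n => simp [coeff_expGen, coeff_succ_X_mul, expGenDiv]

/-- `X` is central although the coefficients do not commute, so `X` can be pulled out of the power.
The vanishing for `n < k` is the triangularity of the system. -/
theorem coeff_expGen_pow (a : ℕ → A) (n k : ℕ) :
    coeff n (expGen 𝕜 a ^ k) = if k ≤ n then coeff (n - k) (expGenDiv 𝕜 a ^ k) else 0 := by
  rw [expGen_eq_X_mul, (commute_X _).symm.mul_pow, coeff_X_pow_mul']

/-- The diagonal entries of the triangular system; they are invertible exactly because `a 1` is. -/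
theorem evalAt_bellPolyII_self [CharZero 𝕜] (a : ℕ → A) (n : ℕ) :
    evalAt a (bellPolyII 𝕜 n n) = a 1 ^ n := by
  rw [evalAt_bellPolyII, coeff_expGen_pow, if_pos le_rfl, Nat.sub_self,
    div_self (Nat.cast_ne_zero.2 n.factorial_ne_zero), one_smul, coeff_zero_eq_constantCoeff_apply,
    map_pow]
  simp [expGenDiv, ← coeff_zero_eq_constantCoeff_apply]

end Algebra

/-! ### The triangular system and its recursive solution -/

section WordEquation

open PowerSeries

variable {𝕜 A : Type*} [RCLike 𝕜] [Ring A] [Algebra 𝕜 A]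

theorem evalAt_bellPolyII_zero_right (a : ℕ → A) (n : ℕ) :
    evalAt a (bellPolyII 𝕜 n 0) = if n = 0 then 1 else 0 := by
  rw [evalAt_bellPolyII, pow_zero, coeff_one]
  split_ifs with h <;> simp [h]

/-- As `B̂_{n,0}` is `1` for `n = 0` and `0` otherwise, admitting `k = 0` in the sum merges the
separate equation for `F 0` with the others. -/
theorem solvesWordEquation_iff (a F : ℕ → A) :
    SolvesWordEquation (𝕜 := 𝕜) a F ↔
      ∀ n, evalAt a (bipartitionPoly 𝕜 (n + 2)) =
        ∑ k ∈ Finset.range (n + 1), F k * evalAt a (bellPolyII 𝕜 n k) := by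
  have key : ∀ n, 1 ≤ n → ∑ k ∈ Finset.range (n + 1), F k * evalAt a (bellPolyII 𝕜 n k) =
      ∑ k ∈ Finset.Icc 1 n, F k * evalAt a (bellPolyII 𝕜 n k) := by
    intro n hn
    rw [Finset.range_eq_Ico, Finset.sum_eq_sum_Ico_succ_bot (Nat.succ_pos n),
      evalAt_bellPolyII_zero_right, if_neg (by omega), mul_zero, zero_add]
    rfl
  constructor
  · rintro ⟨h0, h⟩ n
    rcases Nat.eq_zero_or_pos n with rfl | hn
    · simp [evalAt_bellPolyII_zero_right, h0]
    · rw [key n hn, h n hn]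
  · intro h
    refine ⟨?_, fun n hn => by rw [h n, key n hn]⟩
    have := h 0
    simp only [zero_add, Finset.range_one, Finset.sum_singleton,
      evalAt_bellPolyII_zero_right, if_true, mul_one] at this
    exact this.symm

/-- The recursive solution of the word equation. -/
noncomputable def wordSolution (𝕜 : Type*) {A : Type*} [RCLike 𝕜] [Ring A] [Algebra 𝕜 A]
    (a : ℕ → A) (R : A) : ℕ → A
  | n => evalAt a (bipartitionPoly 𝕜 (n + 2)) * R ^ n -
      ∑ k : Fin n, wordSolution 𝕜 a R k * evalAt a (bellPolyII 𝕜 n k) * R ^ n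
  termination_by n => n
  decreasing_by exact k.2

theorem wordSolution_eq (a : ℕ → A) (R : A) (n : ℕ) :
    wordSolution 𝕜 a R n = evalAt a (bipartitionPoly 𝕜 (n + 2)) * R ^ n -
      ∑ k ∈ Finset.range n, wordSolution 𝕜 a R k * evalAt a (bellPolyII 𝕜 n k) * R ^ n := by
  rw [wordSolution,
    Finset.sum_range fun k => wordSolution 𝕜 a R k * evalAt a (bellPolyII 𝕜 n k) * R ^ n]

theorem pow_mul_pow_eq_one_of_mul_eq_one {M : Type*} [Monoid M] {x y : M} (h : x * y = 1) (n : ℕ) :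
    x ^ n * y ^ n = 1 := by
  induction n with
  | zero => simp
  | succ n ih => rw [pow_succ, pow_succ', mul_assoc, ← mul_assoc x, h, one_mul, ih]

/-- Forward substitution: each equation is solved for its diagonal term `F n * a 1 ^ n`. Uniqueness
uses `a 1 * R = 1`, existence uses `R * a 1 = 1`. -/
theorem solvesWordEquation_iff_eq (a : ℕ → A) (R : A) (hR : a 1 * R = 1) (hR' : R * a 1 = 1)
    (F : ℕ → A) :
    SolvesWordEquation (𝕜 := 𝕜) a F ↔ F = wordSolution 𝕜 a R := by
  rw [solvesWordEquation_iff]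
  have hp := pow_mul_pow_eq_one_of_mul_eq_one hR
  have hp' := pow_mul_pow_eq_one_of_mul_eq_one hR'
  constructor
  · intro h
    funext n
    induction n using Nat.strong_induction_on with
    | _ n ih =>
      rw [wordSolution_eq, h n, Finset.sum_range_succ, evalAt_bellPolyII_self, add_mul,
        Finset.sum_mul, mul_assoc (F n), hp, mul_one,
        Finset.sum_congr rfl fun k hk => by rw [ih k (Finset.mem_range.1 hk)]]
      abel
  · rintro rfl n
    rw [Finset.sum_range_succ, evalAt_bellPolyII_self]
    conv_rhs => rw [wordSolution_eq (n := n)]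
    rw [sub_mul, Finset.sum_mul, mul_assoc _ (R ^ n), hp', mul_one]
    simp_rw [mul_assoc _ (R ^ n), hp', mul_one]
    abel

theorem wordSolution_zero (a : ℕ → A) (R : A) : wordSolution 𝕜 a R 0 = a 2 - a 1 ^ 2 := by
  rw [wordSolution_eq, evalAt_bipartitionPoly_two]
  simp

theorem wordSolution_eq_sum_Icc (a : ℕ → A) (R : A) (n : ℕ) (hn : 1 ≤ n) :
    wordSolution 𝕜 a R n = evalAt a (bipartitionPoly 𝕜 (n + 2)) * R ^ n -
      ∑ k ∈ Finset.Icc 1 (n - 1),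
        wordSolution 𝕜 a R k * evalAt a (bellPolyII 𝕜 n k) * R ^ n := by
  obtain ⟨m, rfl⟩ : ∃ m, n = m + 1 := ⟨n - 1, by omega⟩
  rw [wordSolution_eq, Finset.range_eq_Ico, Finset.sum_eq_sum_Ico_succ_bot (Nat.succ_pos m),
      evalAt_bellPolyII_zero_right, if_neg (by omega), mul_zero, zero_mul, zero_add]
  rfl

theorem wordSolution_mem (a : ℕ → A) (R : A) (n : ℕ) :
    wordSolution 𝕜 a R n ∈ Algebra.adjoin 𝕜 (insert R (a '' Ici 1)) := by
  have ha : ∀ j, 1 ≤ j → a j ∈ Algebra.adjoin 𝕜 (insert R (a '' Ici 1)) := fun j hj =>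
    Algebra.subset_adjoin (mem_insert_of_mem _ (mem_image_of_mem a hj))
  have hR : R ∈ Algebra.adjoin 𝕜 (insert R (a '' Ici 1)) :=
    Algebra.subset_adjoin (mem_insert _ _)
  induction n using Nat.strong_induction_on with
  | _ n ih =>
    rw [wordSolution_eq]
    refine sub_mem (mul_mem (evalAt_bipartitionPoly_mem a _ ha _) (pow_mem hR n))
      (sum_mem fun k hk => ?_)
    exact mul_mem (mul_mem (ih k (Finset.mem_range.1 hk)) (evalAt_bellPolyII_mem a _ ha _ _))
      (pow_mem hR n)

/-- Lets norm estimates take place in the Banach algebra of bounded operators, while the theorem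
speaks of arbitrary linear maps. -/
theorem map_wordSolution {B : Type*} [Ring B] [Algebra 𝕜 B] (f : A →ₐ[𝕜] B) (a : ℕ → A) (R : A)
    (n : ℕ) : f (wordSolution 𝕜 a R n) = wordSolution 𝕜 (fun j => f (a j)) (f R) n := by
  induction n using Nat.strong_induction_on with
  | _ n ih =>
    rw [wordSolution_eq, wordSolution_eq, map_sub, map_sum, map_mul, map_evalAt, map_pow]
    congr 1
    refine Finset.sum_congr rfl fun k hk => ?_
    rw [map_mul, map_mul, map_evalAt, map_pow, ih k (Finset.mem_range.1 hk)]

/-- The word equation in terms of exponential generating series. -/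
theorem smul_bipartitionPoly_eq_sum (a : ℕ → A) (R : A) (hR : a 1 * R = 1) (hR' : R * a 1 = 1)
    (n : ℕ) :
    ((n ! : 𝕜)⁻¹) • evalAt a (bipartitionPoly 𝕜 (n + 2)) =
      ∑ k ∈ Finset.range (n + 1),
        (((k ! : 𝕜)⁻¹) • wordSolution 𝕜 a R k) * coeff n (expGen 𝕜 a ^ k) := by
  rw [(solvesWordEquation_iff a _).1
    ((solvesWordEquation_iff_eq a R hR hR' (wordSolution 𝕜 a R)).2 rfl) n, Finset.smul_sum]
  refine Finset.sum_congr rfl fun k _ => ?_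
  rw [evalAt_bellPolyII, mul_smul_comm, smul_smul, smul_mul_assoc]
  congr 1
  have : (n ! : 𝕜) ≠ 0 := Nat.cast_ne_zero.2 n.factorial_ne_zero
  field_simp

end WordEquation

/-! ### A residue identity replacing Lagrange inversion -/

section Residues

open PowerSeries

variable {A : Type*} [Ring A]

/-- The coefficients of the right inverse of the power series `U` whose constant coefficient has
the inverse `R`. -/
noncomputable def rightInvCoeff (U : A⟦X⟧) (R : A) : ℕ → A
  | 0 => R
  | n + 1 => -(R * ∑ i : Fin (n + 1), coeff (n + 1 - i) U * rightInvCoeff U R i)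
  termination_by n => n
  decreasing_by exact i.2

/-- The right inverse of the power series `U` whose constant coefficient has the inverse `R`. -/
noncomputable def rightInv (U : A⟦X⟧) (R : A) : A⟦X⟧ := PowerSeries.mk (rightInvCoeff U R)

theorem coeff_zero_rightInv (U : A⟦X⟧) (R : A) : coeff 0 (rightInv U R) = R := by
  simp [rightInv, rightInvCoeff]

theorem coeff_succ_rightInv (U : A⟦X⟧) (R : A) (n : ℕ) :
    coeff (n + 1) (rightInv U R) =
      -(R * ∑ i ∈ Finset.range (n + 1), coeff (n + 1 - i) U * coeff i (rightInv U R)) := by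
  simp only [rightInv, coeff_mk]
  rw [rightInvCoeff, Finset.sum_range fun i => coeff (n + 1 - i) U * rightInvCoeff U R i]

theorem mul_rightInv (U : A⟦X⟧) (R : A) (h : coeff 0 U * R = 1) : U * rightInv U R = 1 := by
  ext n
  rw [coeff_mul, Finset.Nat.sum_antidiagonal_eq_sum_range_succ
    (fun i j => coeff i U * coeff j (rightInv U R)), ← Finset.sum_range_reflect, coeff_one]
  cases n with
  | zero => simp [coeff_zero_rightInv, ← h]
  | succ n =>
    rw [if_neg (Nat.succ_ne_zero n), Finset.sum_range_succ]
    rw [show (n + 1).succ - 1 - (n + 1) = 0 by omega, Nat.sub_zero, coeff_succ_rightInv, mul_neg,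
      ← mul_assoc, h, one_mul, add_neg_eq_zero]
    refine Finset.sum_congr rfl fun i hi => ?_
    have := Finset.mem_range.1 hi
    congr 3
    omega

/-- If `p = ∑_k f_k (X U)^k` and `W = U⁻¹`, then the `m`-th coefficient of `p W^{m+1}` is
`∑_k f_k` times the `(m-k)`-th coefficient of `W^{m-k+1}`. -/
theorem coeff_mul_pow_succ_of_eq_sum (p U W : A⟦X⟧) (hUW : U * W = 1) (f : ℕ → A)
    (hp : ∀ n, coeff n p = ∑ k ∈ Finset.range (n + 1), f k * coeff n ((X * U) ^ k)) (m : ℕ) :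
    coeff m (p * W ^ (m + 1)) =
      ∑ k ∈ Finset.range (m + 1), f k * coeff (m - k) (W ^ (m - k + 1)) := by
  -- Only coefficients of `p` of order at most `m` enter, and `(X U)^k` starts in degree `k`, so `p`
  -- may be replaced by a finite sum.
  have h1 : coeff m (p * W ^ (m + 1)) =
      coeff m ((∑ k ∈ Finset.range (m + 1), C (f k) * (X * U) ^ k) * W ^ (m + 1)) := by
    rw [coeff_mul, coeff_mul]
    refine Finset.sum_congr rfl fun q hq => ?_
    have hq' : q.1 ≤ m := Finset.HasAntidiagonal.antidiagonal.fst_le hq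
    congr 1
    rw [hp, map_sum]
    simp only [coeff_C_mul]
    refine Finset.sum_subset (Finset.range_mono (by omega)) fun k _ hk => ?_
    rw [Finset.mem_range, not_lt] at hk
    rw [(commute_X U).symm.mul_pow, coeff_X_pow_mul', if_neg (by omega), mul_zero]
  rw [h1, Finset.sum_mul, map_sum]
  refine Finset.sum_congr rfl fun k hk => ?_
  have hk' : k ≤ m := Nat.lt_succ_iff.1 (Finset.mem_range.1 hk)
  -- The factor `W ^ k` cancels `U ^ k`, leaving `X ^ k * W ^ (m - k + 1)`: what multiplies `f k`
  -- depends on `m - k` alone.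
  have h2 : W ^ (m + 1) = W ^ k * W ^ (m - k + 1) := by
    rw [← pow_add]; congr 1; omega
  rw [mul_assoc, coeff_C_mul, (commute_X U).symm.mul_pow, h2, mul_assoc, ← mul_assoc (U ^ k),
    pow_mul_pow_eq_one_of_mul_eq_one hUW, one_mul, coeff_X_pow_mul', if_pos hk']

end Residues

/-! ### Geometric growth of the coefficients -/

section Bounds

/-- Sequences that grow at most geometrically. -/
def GeomBounded {E : Type*} [Norm E] (c : ℕ → E) : Prop :=
  ∃ C M : ℝ, 1 ≤ C ∧ 1 ≤ M ∧ ∀ n, ‖c n‖ ≤ C * M ^ n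

theorem GeomBounded.exists_common {E E' : Type*} [Norm E] [Norm E'] {c : ℕ → E} {d : ℕ → E'}
    (hc : GeomBounded c) (hd : GeomBounded d) :
    ∃ C M : ℝ, 1 ≤ C ∧ 1 ≤ M ∧ (∀ n, ‖c n‖ ≤ C * M ^ n) ∧ ∀ n, ‖d n‖ ≤ C * M ^ n := by
  obtain ⟨C, M, hC, hM, h⟩ := hc
  obtain ⟨C', M', hC', hM', h'⟩ := hd
  refine ⟨max C C', max M M', le_max_of_le_left hC, le_max_of_le_left hM,
    fun n => (h n).trans ?_, fun n => (h' n).trans ?_⟩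
  · gcongr <;> exact le_max_left _ _
  · gcongr <;> exact le_max_right _ _

/-- A renewal inequality with geometric kernel. The bound reproduces itself because `1 + ∑_{k<n} C
(1 + C)^k = (1 + C)^n`. -/
theorem le_of_le_add_sum {w : ℕ → ℝ} {C M : ℝ} (hC : 0 ≤ C) (hM : 0 ≤ M)
    (h : ∀ n, w n ≤ C * M ^ n + ∑ k ∈ Finset.range n, w k * (C * M ^ (n - k))) (n : ℕ) :
    w n ≤ C * (M * (1 + C)) ^ n := by
  induction n using Nat.strong_induction_on with
  | _ n ih =>
    refine (h n).trans ?_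
    -- `C` is written as `(1 + C) - 1` to telescope the geometric sum.
    have h1 : ∑ k ∈ Finset.range n, w k * (C * M ^ (n - k)) ≤
        ∑ k ∈ Finset.range n, C * M ^ n * (((1 + C) - 1) * (1 + C) ^ k) := by
      refine Finset.sum_le_sum fun k hk => ?_
      refine (mul_le_mul_of_nonneg_right (ih k (Finset.mem_range.1 hk)) (by positivity)).trans ?_
      have : M ^ n = M ^ k * M ^ (n - k) := by
        rw [← pow_add, Nat.add_sub_cancel' (Finset.mem_range.1 hk).le]
      rw [this, mul_pow]
      apply le_of_eq
      ring
    have h2 : ∑ k ∈ Finset.range n, C * M ^ n * (((1 + C) - 1) * (1 + C) ^ k) =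
        C * M ^ n * ((1 + C) ^ n - 1) := by
      rw [← Finset.mul_sum, ← Finset.mul_sum, mul_geom_sum]
    rw [h2] at h1
    calc _ ≤ C * M ^ n + C * M ^ n * ((1 + C) ^ n - 1) := by gcongr
      _ = _ := by rw [mul_pow]; ring

variable {A : Type*} [NormedRing A]

open PowerSeries

/-- Each convolution would cost a factor `n + 1`. Enlarging `M` to `2 * M` replaces it by `∑ 2^i ≤ 2
* 2^n`, a constant factor per multiplication. Only positive powers occur, since `‖1‖` is not
controlled. -/
theorem norm_coeff_pow_succ_le {W : A⟦X⟧} {C M : ℝ} (hC : 0 ≤ C) (hM : 0 ≤ M)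
    (h : ∀ n, ‖coeff n W‖ ≤ C * M ^ n) (k n : ℕ) :
    ‖coeff n (W ^ (k + 1))‖ ≤ (2 * C) ^ (k + 1) * (2 * M) ^ n := by
  induction k generalizing n with
  | zero =>
    rw [zero_add, pow_one, pow_one]
    refine (h n).trans ?_
    gcongr <;> linarith
  | succ k ih =>
    rw [pow_succ, coeff_mul, Finset.Nat.sum_antidiagonal_eq_sum_range_succ
      (fun i j => coeff i (W ^ (k + 1)) * coeff j W)]
    have h1 : ∀ i ∈ Finset.range (n + 1), ‖coeff i (W ^ (k + 1)) * coeff (n - i) W‖ ≤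
        (2 * C) ^ (k + 1) * C * M ^ n * 2 ^ i := by
      intro i hi
      have hi' : i ≤ n := Nat.lt_succ_iff.1 (Finset.mem_range.1 hi)
      have : M ^ n = M ^ i * M ^ (n - i) := by rw [← pow_add, Nat.add_sub_cancel' hi']
      calc _ ≤ ‖coeff i (W ^ (k + 1))‖ * ‖coeff (n - i) W‖ := norm_mul_le _ _
        _ ≤ ((2 * C) ^ (k + 1) * (2 * M) ^ i) * (C * M ^ (n - i)) := by
          gcongr
          · exact ih i
          · exact h _
        _ = _ := by rw [this, mul_pow 2 M]; ring
    refine (norm_sum_le_of_le _ h1).trans ?_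
    rw [← Finset.mul_sum]
    have h2 : ∑ i ∈ Finset.range (n + 1), (2 : ℝ) ^ i ≤ 2 * 2 ^ n := by
      have := geom_sum_eq (x := (2 : ℝ)) (by norm_num) (n + 1)
      rw [this, pow_succ]; norm_num; linarith
    calc _ ≤ (2 * C) ^ (k + 1) * C * M ^ n * (2 * 2 ^ n) := by gcongr
      _ = _ := by rw [mul_pow 2 M, pow_succ _ (k + 1)]; ring

/-- The recursion for the inverse series is a renewal inequality with kernel `‖R‖ * C * M ^ n`; the
`max` only makes the constant at least `1`. -/
theorem geomBounded_rightInv {U : A⟦X⟧} (R : A) (hU : GeomBounded fun n => coeff n U) :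
    GeomBounded fun n => coeff n (rightInv U R) := by
  obtain ⟨C, M, hC, hM, h⟩ := hU
  set D := max ‖R‖ 1 * C with hD
  have hD1 : 1 ≤ D := one_le_mul_of_one_le_of_one_le (le_max_right _ _) hC
  have hRD : ‖R‖ * C ≤ D := by rw [hD]; gcongr; exact le_max_left _ _
  refine ⟨D, M * (1 + D), hD1, one_le_mul_of_one_le_of_one_le hM (by linarith), fun n => ?_⟩
  refine le_of_le_add_sum (w := fun n => ‖coeff n (rightInv U R)‖) (zero_le_one.trans hD1)
    (zero_le_one.trans hM) (fun n => ?_) n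
  cases n with
  | zero =>
    simp only [coeff_zero_rightInv, pow_zero, mul_one, Finset.range_zero, Finset.sum_empty,
      add_zero]
    exact (le_mul_of_one_le_right (norm_nonneg R) hC).trans hRD
  | succ n =>
    rw [coeff_succ_rightInv, norm_neg]
    refine le_add_of_nonneg_of_le (by positivity) ?_
    refine (norm_mul_le _ _).trans ?_
    refine (mul_le_mul_of_nonneg_left (norm_sum_le _ _) (norm_nonneg R)).trans ?_
    rw [Finset.mul_sum]
    refine Finset.sum_le_sum fun i _ => ?_
    calc ‖R‖ * ‖coeff (n + 1 - i) U * coeff i (rightInv U R)‖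
        ≤ ‖R‖ * (C * M ^ (n + 1 - i) * ‖coeff i (rightInv U R)‖) := by
          gcongr
          refine (norm_mul_le _ _).trans ?_
          gcongr
          exact h _
      _ = ‖coeff i (rightInv U R)‖ * (‖R‖ * C * M ^ (n + 1 - i)) := by ring
      _ ≤ _ := by gcongr

/-- If `p = ∑_k f_k (X U)^k`, where `U` has an invertible constant coefficient and `p` and `U`
have coefficients of at most geometric growth, then so has `f`. -/
theorem geomBounded_of_eq_sum_mul_pow {p U : A⟦X⟧} {R : A}
    (hR : coeff 0 U * R = 1) (hR' : R * coeff 0 U = 1) {f : ℕ → A}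
    (hf : ∀ n, coeff n p = ∑ k ∈ Finset.range (n + 1), f k * coeff n ((X * U) ^ k))
    (hp : GeomBounded fun n => coeff n p) (hU : GeomBounded fun n => coeff n U) :
    GeomBounded f := by
  set W := rightInv U R with hW
  obtain ⟨C, M, hC, hM, hpC, hWC⟩ := hp.exists_common (geomBounded_rightInv R hU)
  have hC0 : 0 ≤ C := by linarith
  have hM0 : 0 ≤ M := by linarith
  -- The power grows with the index, but the bound for powers is exponential in both, so the result
  -- is still geometric.
  have hj : ∀ i, ‖coeff i (W ^ (i + 1))‖ ≤ 2 * C * (4 * C * M) ^ i := by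
    intro i
    refine (norm_coeff_pow_succ_le hC0 hM0 hWC i i).trans (le_of_eq ?_)
    rw [show 4 * C * M = (2 * C) * (2 * M) by ring, mul_pow (2 * C), pow_succ]; ring
  have hq : ∀ m, ‖coeff m (p * W ^ (m + 1))‖ ≤ 4 * C ^ 2 * (8 * C * M) ^ m := by
    intro m
    rw [coeff_mul, Finset.Nat.sum_antidiagonal_eq_sum_range_succ
      (fun i j => coeff i p * coeff j (W ^ (m + 1)))]
    have h1 : ∀ i ∈ Finset.range (m + 1), ‖coeff i p * coeff (m - i) (W ^ (m + 1))‖ ≤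
        C * (2 * C) ^ (m + 1) * M ^ m * 2 ^ m := by
      intro i hi
      have hi' : i ≤ m := Nat.lt_succ_iff.1 (Finset.mem_range.1 hi)
      have : M ^ m = M ^ i * M ^ (m - i) := by rw [← pow_add, Nat.add_sub_cancel' hi']
      calc _ ≤ ‖coeff i p‖ * ‖coeff (m - i) (W ^ (m + 1))‖ := norm_mul_le _ _
        _ ≤ (C * M ^ i) * ((2 * C) ^ (m + 1) * (2 * M) ^ (m - i)) := by
          gcongr
          · exact hpC i
          · exact norm_coeff_pow_succ_le hC0 hM0 hWC _ _
        _ = C * (2 * C) ^ (m + 1) * M ^ m * 2 ^ (m - i) := by rw [this, mul_pow 2 M]; ring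
        _ ≤ _ := by
          gcongr
          · norm_num
          · exact Nat.sub_le m i
    refine (norm_sum_le_of_le _ h1).trans ?_
    rw [Finset.sum_const, Finset.card_range, nsmul_eq_mul]
    have h2 : ((m + 1 : ℕ) : ℝ) ≤ 2 * 2 ^ m := by
      have : m + 1 ≤ 2 * 2 ^ m := by
        have := (Nat.lt_two_pow_self (n := m)); omega
      exact_mod_cast this
    calc _ ≤ (2 * 2 ^ m) * (C * (2 * C) ^ (m + 1) * M ^ m * 2 ^ m) := by gcongr
      _ = 4 * C ^ 2 * (2 ^ m * 2 ^ m * 2 ^ m * C ^ m * M ^ m) := by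
          rw [mul_pow 2 C, pow_succ, pow_succ]; ring
      _ = _ := by
          rw [← mul_pow, ← mul_pow, ← mul_pow, ← mul_pow]; norm_num
  -- The residue identity solved for `f m`: the factor at `k = m` is `coeff 0 W = R`, undone by
  -- `coeff 0 U` on the right.
  have hrec : ∀ m, f m = coeff m (p * W ^ (m + 1)) * coeff 0 U -
      ∑ k ∈ Finset.range m, f k * coeff (m - k) (W ^ (m - k + 1)) * coeff 0 U := by
    intro m
    rw [coeff_mul_pow_succ_of_eq_sum p U W (mul_rightInv U R hR) f hf m, Finset.sum_range_succ,
      Nat.sub_self, zero_add, pow_one, coeff_zero_rightInv, add_mul, Finset.sum_mul,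
      mul_assoc (f m), hR', mul_one, add_sub_cancel_left]
  set B := max ‖coeff 0 U‖ 1 with hB
  have hB1 : 1 ≤ B := le_max_right _ _
  have hUB : ‖coeff 0 U‖ ≤ B := le_max_left _ _
  have hCB : 1 ≤ 4 * C ^ 2 * B := by nlinarith
  have hCM : 1 ≤ 8 * C * M := by nlinarith
  refine ⟨4 * C ^ 2 * B, 8 * C * M * (1 + 4 * C ^ 2 * B), hCB,
    one_le_mul_of_one_le_of_one_le hCM (by linarith), fun n => ?_⟩
  refine le_of_le_add_sum (w := fun n => ‖f n‖) (by linarith) (by linarith) (fun n => ?_) n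
  rw [hrec n]
  refine (norm_sub_le _ _).trans (add_le_add ?_ ?_)
  · refine (norm_mul_le _ _).trans ?_
    calc _ ≤ (4 * C ^ 2 * (8 * C * M) ^ n) * B := by gcongr; exact hq n
      _ = _ := by ring
  · refine norm_sum_le_of_le _ fun k _ => ?_
    rw [mul_assoc]
    refine (norm_mul_le _ _).trans ?_
    gcongr
    refine (norm_mul_le _ _).trans ?_
    calc _ ≤ (2 * C * (4 * C * M) ^ (n - k)) * B := by gcongr; exact hj _
      _ ≤ (4 * C ^ 2 * (8 * C * M) ^ (n - k)) * B := by
        gcongr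
        · norm_num
        · nlinarith
        · norm_num
      _ = _ := by ring

end Bounds

/-! ### One-sided asymptotic expansions -/

section Expansions

open Asymptotics

variable {E F : Type*} [NormedAddCommGroup E] [NormedSpace ℝ E] [NormedAddCommGroup F]
  [NormedSpace ℝ F]

/-- The function `g` has the one-sided asymptotic expansion `∑_n s^n c_n` as `s → 0+`. -/
def HasExpansion (g : ℝ → E) (c : ℕ → E) : Prop :=
  ∀ N : ℕ, (fun s : ℝ => g s - ∑ n ∈ Finset.range N, s ^ n • c n) =O[𝓝[≥] 0] fun s => s ^ N

theorem isBigO_pow_pow_nhdsGE {m n : ℕ} (h : m ≤ n) :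
    (fun s : ℝ => s ^ n) =O[𝓝[≥] 0] fun s => s ^ m := by
  refine IsBigO.of_bound 1 ?_
  filter_upwards [Icc_mem_nhdsGE (zero_lt_one' ℝ)] with s hs
  rw [norm_pow, norm_pow, Real.norm_of_nonneg hs.1, one_mul]
  exact pow_le_pow_of_le_one hs.1 hs.2 h

theorem isBigO_pow_smul_const (n : ℕ) (x : E) :
    (fun s : ℝ => s ^ n • x) =O[𝓝[≥] 0] fun s => s ^ n := by
  refine IsBigO.of_bound ‖x‖ (Eventually.of_forall fun s => ?_)
  rw [norm_smul, mul_comm]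

theorem HasExpansion.of_succ {g : ℝ → E} {c : ℕ → E}
    (h : ∀ N : ℕ, (fun s : ℝ => g s - ∑ n ∈ Finset.range (N + 1), s ^ n • c n) =O[𝓝[≥] 0]
      fun s => s ^ (N + 1)) : HasExpansion g c := by
  intro N
  have := ((h N).trans (isBigO_pow_pow_nhdsGE N.le_succ)).add (isBigO_pow_smul_const N (c N))
  refine this.congr_left fun s => ?_
  rw [Finset.sum_range_succ]
  abel

theorem HasExpansion.congr {g g' : ℝ → E} {c : ℕ → E} (h : HasExpansion g c)
    (hg : g =ᶠ[𝓝[≥] 0] g') : HasExpansion g' c := fun N =>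
  (h N).congr' (hg.mono fun s hs => by simp only [hs]) EventuallyEq.rfl

theorem HasExpansion.sub {g g' : ℝ → E} {c c' : ℕ → E} (h : HasExpansion g c)
    (h' : HasExpansion g' c') : HasExpansion (fun s => g s - g' s) (fun n => c n - c' n) :=
  fun N => ((h N).sub (h' N)).congr_left fun s => by
    simp only [smul_sub, Finset.sum_sub_distrib]
    abel

theorem HasExpansion.sum {ι : Type*} (t : Finset ι) {g : ι → ℝ → E} {c : ι → ℕ → E}
    (h : ∀ i ∈ t, HasExpansion (g i) (c i)) :
    HasExpansion (fun s => ∑ i ∈ t, g i s) (fun n => ∑ i ∈ t, c i n) := fun N =>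
  (IsBigO.sum fun i hi => h i hi N).congr_left fun s => by
    simp only [Finset.sum_apply, Finset.smul_sum, Finset.sum_sub_distrib]
    rw [Finset.sum_comm]

theorem hasExpansion_const (x : E) :
    HasExpansion (fun _ => x) (fun n => if n = 0 then x else 0) := by
  refine HasExpansion.of_succ fun N => ?_
  simp [isBigO_zero]

theorem HasExpansion.map {𝕜 : Type*} [RCLike 𝕜] [NormedSpace 𝕜 E] [NormedSpace 𝕜 F]
    [IsScalarTower ℝ 𝕜 E] [IsScalarTower ℝ 𝕜 F] (f : E →L[𝕜] F) {g : ℝ → E} {c : ℕ → E}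
    (h : HasExpansion g c) : HasExpansion (fun s => f (g s)) (fun n => f (c n)) := fun N =>
  ((f.isBigO_comp (fun s => g s - ∑ n ∈ Finset.range N, s ^ n • c n) _).trans
    (h N)).congr_left fun s => by
    rw [map_sub, map_sum]
    congr 1
    exact Finset.sum_congr rfl fun n _ => map_smul (f.restrictScalars ℝ) _ _

theorem HasExpansion.isBigO_of_eq_zero {g : ℝ → E} {c : ℕ → E} (h : HasExpansion g c) {N : ℕ}
    (hc : ∀ n < N, c n = 0) : g =O[𝓝[≥] 0] fun s => s ^ N :=
  (h N).congr_left fun s => by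
    rw [Finset.sum_eq_zero fun n hn => by rw [hc n (Finset.mem_range.1 hn), smul_zero], sub_zero]

/-- If all earlier coefficients vanish, divide the remainder of order `N + 1` by `s ^ N` and let `s
→ 0+`. -/
theorem HasExpansion.eq_zero {c : ℕ → E} (h : HasExpansion (fun _ => 0) c) (N : ℕ) : c N = 0 := by
  induction N using Nat.strong_induction_on with
  | _ N ih =>
    have h1 := h (N + 1)
    obtain ⟨C, hC⟩ := h1.bound
    have h2 : ∀ᶠ s : ℝ in 𝓝[>] 0, ‖c N‖ ≤ C * s := by
      filter_upwards [hC.filter_mono (nhdsWithin_mono 0 Ioi_subset_Ici_self),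
        self_mem_nhdsWithin] with s hs hs0
      have hs0' : (0 : ℝ) < s := hs0
      rw [Finset.sum_range_succ, Finset.sum_eq_zero fun n hn => by
        rw [ih n (Finset.mem_range.1 hn), smul_zero], zero_add, zero_sub, norm_neg, norm_smul,
        norm_pow, norm_pow, Real.norm_of_nonneg hs0'.le, pow_succ] at hs
      have : s ^ N * ‖c N‖ ≤ s ^ N * (C * s) := by linarith
      exact le_of_mul_le_mul_left this (by positivity)
    have h3 : Tendsto (fun s : ℝ => C * s) (𝓝[>] 0) (𝓝 0) := by
      have : Tendsto (fun s : ℝ => C * s) (𝓝 0) (𝓝 (C * 0)) := (continuous_const_mul C).tendsto 0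
      rw [mul_zero] at this
      exact this.mono_left nhdsWithin_le_nhds
    exact norm_le_zero_iff.1 (ge_of_tendsto h3 h2)

theorem HasExpansion.unique {g : ℝ → E} {c d : ℕ → E} (h : HasExpansion g c)
    (h' : HasExpansion g d) : c = d := by
  funext n
  have := h.sub h'
  simp only [sub_self] at this
  exact sub_eq_zero.1 (this.eq_zero n)

theorem hasExpansion_of_contDiffOn {g : ℝ → E} (h : ContDiffOn ℝ ∞ g (Ici 0)) :
    ∃ c : ℕ → E, HasExpansion g c := by
  refine ⟨fun n => ((n ! : ℝ)⁻¹) • iteratedDerivWithin n g (Icc 0 1) 0,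
    HasExpansion.of_succ fun N => ?_⟩
  obtain ⟨C, hC⟩ := exists_taylor_mean_remainder_bound (f := g) (n := N) zero_le_one
    ((h.mono Icc_subset_Ici_self).of_le (by exact_mod_cast le_top))
  refine IsBigO.of_bound C ?_
  filter_upwards [Icc_mem_nhdsGE (zero_lt_one' ℝ)] with s hs
  have := hC s hs
  rw [taylor_within_apply] at this
  rw [norm_pow, Real.norm_of_nonneg hs.1]
  simpa only [sub_zero, smul_smul, mul_comm] using this

/-- A function that is analytic from the right at `0` is expanded in its power series. -/
theorem exists_hasFPowerSeriesAt_hasExpansion [CompleteSpace E] {g : ℝ → E} {δ : ℝ} (hδ : 0 < δ)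
    (h : AnalyticWithinAt ℝ g (Ico 0 δ) 0) :
    ∃ (p : FormalMultilinearSeries ℝ ℝ E) (g' : ℝ → E), HasFPowerSeriesAt g' p 0 ∧
      g' =ᶠ[𝓝[≥] 0] g ∧ HasExpansion g p.coeff := by
  obtain ⟨g', hg', p, hp⟩ := analyticWithinAt_iff_exists_analyticAt.1 h
  have hmem : insert 0 (Ico 0 δ) ∈ 𝓝[≥] (0 : ℝ) :=
    mem_of_superset (Ico_mem_nhdsGE hδ) (subset_insert _ _)
  have hgg : g' =ᶠ[𝓝[≥] 0] g := (hg'.symm).filter_mono (nhdsWithin_le_of_mem hmem)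
  refine ⟨p, g', hp, hgg, HasExpansion.congr (fun N => ?_) hgg⟩
  have := hp.isBigO_sub_partialSum_pow N
  refine ((this.mono nhdsWithin_le_nhds).congr (fun s => ?_) fun s => rfl).trans
    (IsBigO.of_bound 1 (Eventually.of_forall fun s => ?_))
  · rw [zero_add, FormalMultilinearSeries.partialSum]
    simp
  · simp

theorem hasExpansion_of_analyticWithinAt [CompleteSpace E] {g : ℝ → E} {δ : ℝ} (hδ : 0 < δ)
    (h : AnalyticWithinAt ℝ g (Ico 0 δ) 0) :
    ∃ c : ℕ → E, HasExpansion g c ∧ GeomBounded c := by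
  obtain ⟨p, g', hp, -, hE⟩ := exists_hasFPowerSeriesAt_hasExpansion hδ h
  refine ⟨p.coeff, hE, ?_⟩
  obtain ⟨C, r, hC, hr, hb⟩ := p.le_mul_pow_of_radius_pos hp.radius_pos
  refine ⟨max C 1, max r 1, le_max_right _ _, le_max_right _ _, fun n => ?_⟩
  rw [← FormalMultilinearSeries.norm_apply_eq_norm_coef]
  refine (hb n).trans ?_
  gcongr <;> exact le_max_left _ _

theorem hasDerivAt_sum_pow_smul (x : ℕ → E) (N : ℕ) (s : ℝ) :
    HasDerivAt (fun s : ℝ => ∑ k ∈ Finset.range (N + 1), s ^ k • ((k ! : ℝ)⁻¹ • x k))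
      (∑ k ∈ Finset.range N, s ^ k • ((k ! : ℝ)⁻¹ • x (k + 1))) s := by
  have h : ∀ k ∈ Finset.range N, HasDerivAt (fun s : ℝ =>
      s ^ (k + 1) • (((k + 1)! : ℝ)⁻¹ • x (k + 1))) (s ^ k • ((k ! : ℝ)⁻¹ • x (k + 1))) s := by
    intro k _
    refine ((hasDerivAt_pow (k + 1) s).smul_const _).congr_deriv ?_
    rw [Nat.add_sub_cancel, smul_smul, smul_smul, Nat.factorial_succ]
    congr 1
    push_cast
    have : (k ! : ℝ) ≠ 0 := by positivity
    field_simp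
  have := (HasDerivAt.fun_sum h).add_const ((0 ! : ℝ)⁻¹ • x 0)
  refine this.congr_of_eventuallyEq (Eventually.of_forall fun s => ?_)
  simp only [Finset.sum_range_succ' _ N, pow_zero, one_smul]

/-- Taylor expansion of a function all of whose iterated right derivatives exist. -/
theorem hasExpansion_of_hasDerivWithinAt {u : ℕ → ℝ → E} (hc : ∀ n, ContinuousOn (u n) (Ici 0))
    (hu : ∀ n, ∀ s, 0 ≤ s → HasDerivWithinAt (u n) (u (n + 1) s) (Ici s) s) :
    HasExpansion (u 0) (fun n => (n ! : ℝ)⁻¹ • u n 0) := by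
  -- Induction on `N` for all `n` at once: the remainder of order `N + 1` of `u n` has as right
  -- derivative the remainder of order `N` of `u (n + 1)`, and vanishes at `0`.
  have key : ∀ N n : ℕ, (fun s : ℝ => u n s - ∑ k ∈ Finset.range N,
      s ^ k • ((k ! : ℝ)⁻¹ • u (n + k) 0)) =O[𝓝[≥] 0] fun s => s ^ N := by
    intro N
    induction N with
    | zero =>
      intro n
      simp only [Finset.range_zero, Finset.sum_empty, sub_zero, pow_zero]
      exact ((hc n) 0 self_mem_Ici).isBigO_one ℝ
    | succ N ih =>
      intro n
      obtain ⟨C, hC⟩ := (ih (n + 1)).bound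
      obtain ⟨δ, hδ, hδC⟩ := mem_nhdsGE_iff_exists_Ico_subset.1 hC
      refine IsBigO.of_bound C ?_
      filter_upwards [Ico_mem_nhdsGE hδ] with t ht
      have ht0 : 0 ≤ t := ht.1
      have hcont : ContinuousOn (fun s : ℝ => u n s - ∑ k ∈ Finset.range (N + 1),
          s ^ k • ((k ! : ℝ)⁻¹ • u (n + k) 0)) (Icc 0 t) :=
        ((hc n).mono Icc_subset_Ici_self).sub (by fun_prop)
      have hd : ∀ s ∈ Ico 0 t, HasDerivWithinAt (fun s : ℝ => u n s -
          ∑ k ∈ Finset.range (N + 1), s ^ k • ((k ! : ℝ)⁻¹ • u (n + k) 0))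
          (u (n + 1) s - ∑ k ∈ Finset.range N, s ^ k • ((k ! : ℝ)⁻¹ • u (n + 1 + k) 0))
          (Ici s) s := by
        intro s hs
        refine (hu n s hs.1).sub ?_
        have := (hasDerivAt_sum_pow_smul (fun k => u (n + k) 0) N s).hasDerivWithinAt (s := Ici s)
        refine this.congr_deriv ?_
        simp only [add_assoc, add_comm 1]
      have hb : ∀ s ∈ Ico 0 t, ‖u (n + 1) s - ∑ k ∈ Finset.range N,
          s ^ k • ((k ! : ℝ)⁻¹ • u (n + 1 + k) 0)‖ ≤ C * t ^ N := by
        intro s hs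
        have h1 : _ ≤ C * ‖s ^ N‖ := hδC ⟨hs.1, hs.2.trans ht.2⟩
        refine h1.trans ?_
        -- The constant of the big-O bound carries no sign. If it is negative, the bound forces `s ^
        -- N = 0`, and the estimate at `t` gives the claim.
        rcases lt_or_ge C 0 with hC0 | hC0
        · have : ‖s ^ N‖ ≤ 0 := by
            by_contra hh
            push Not at hh
            have := (norm_nonneg _).trans h1
            nlinarith
          have h0 := (norm_nonneg _).trans (hδC (show t ∈ Ico 0 δ from ht))
          rw [norm_pow, Real.norm_of_nonneg ht0] at h0
          rw [le_antisymm this (norm_nonneg _), mul_zero]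
          exact h0
        · rw [norm_pow, Real.norm_of_nonneg hs.1]
          gcongr
          · exact hs.1
          · exact hs.2.le
      have := norm_image_sub_le_of_norm_deriv_right_le_segment hcont hd hb t ⟨ht0, le_rfl⟩
      rw [norm_pow, Real.norm_of_nonneg ht0, pow_succ, ← mul_assoc]
      refine le_trans (le_of_eq ?_) (this.trans (le_of_eq (by ring)))
      congr 1
      rw [Finset.sum_range_succ' (fun k => (0 : ℝ) ^ k • ((k ! : ℝ)⁻¹ • u (n + k) 0))]
      simp
  intro N
  simpa using key N 0

end Expansions

/-! ### Expansions of products and convolutions -/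

section Products

open Asymptotics

variable {𝕜 E F : Type*} [RCLike 𝕜] [NormedAddCommGroup E] [NormedSpace 𝕜 E] [NormedSpace ℝ E]
  [IsScalarTower ℝ 𝕜 E] [NormedAddCommGroup F] [NormedSpace 𝕜 F] [NormedSpace ℝ F]
  [IsScalarTower ℝ 𝕜 F]

/-- Two independent times are kept because a convolution needs `r = t - s`. `G` is expanded only
strongly: its norm bound absorbs the remainder of `h`, and its expansion is used on the finitely
many vectors `c j`. -/
theorem exists_norm_apply_sub_sum_le {G : ℝ → E →L[𝕜] F} {C₀ : ℝ}
    (hG : ∀ᶠ s in 𝓝[≥] 0, ‖G s‖ ≤ C₀) {g : ℕ → E → F}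
    (hg : ∀ v, HasExpansion (fun s => G s v) (fun n => g n v)) {h : ℝ → E} {c : ℕ → E}
    (hh : HasExpansion h c) (N : ℕ) :
    ∃ C δ : ℝ, 0 < δ ∧ ∀ s ∈ Ico 0 δ, ∀ r ∈ Ico 0 δ,
      ‖G r (h s) - ∑ j ∈ Finset.range N, ∑ i ∈ Finset.range (N - j),
        (s ^ j * r ^ i) • g i (c j)‖ ≤ C * (s + r) ^ N := by
  obtain ⟨C₁, hC₁, h1⟩ := (hh N).exists_pos
  have h2 : ∀ j, ∃ C₂ > 0, IsBigOWith C₂ (𝓝[≥] 0) (fun r : ℝ => G r (c j) -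
      ∑ i ∈ Finset.range (N - j), r ^ i • g i (c j)) fun r => r ^ (N - j) :=
    fun j => (hg (c j) (N - j)).exists_pos
  choose C₂ hC₂ h2 using h2
  have hev := (hG.and h1.bound).and
    ((Finset.eventually_all (Finset.range N)).2 fun j _ => (h2 j).bound)
  obtain ⟨δ, hδ, hsub⟩ := mem_nhdsGE_iff_exists_Ico_subset.1 hev
  refine ⟨|C₀| * C₁ + ∑ j ∈ Finset.range N, C₂ j, δ, hδ, fun s hs r hr => ?_⟩
  obtain ⟨⟨-, hs1⟩, -⟩ := hsub hs
  obtain ⟨⟨hr0, -⟩, hr2⟩ := hsub hr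
  have hs0 : 0 ≤ s := hs.1
  have hr0' : 0 ≤ r := hr.1
  have e : G r (h s) - ∑ j ∈ Finset.range N, ∑ i ∈ Finset.range (N - j),
        (s ^ j * r ^ i) • g i (c j) =
      G r (h s - ∑ j ∈ Finset.range N, s ^ j • c j) +
      ∑ j ∈ Finset.range N, s ^ j • (G r (c j) -
        ∑ i ∈ Finset.range (N - j), r ^ i • g i (c j)) := by
    simp only [map_sub, map_sum, smul_sub, Finset.sum_sub_distrib, Finset.smul_sum, smul_smul,
      ContinuousLinearMap.map_smul_of_tower]
    abel
  rw [e, add_mul, Finset.sum_mul]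
  refine (norm_add_le _ _).trans (add_le_add ?_ (norm_sum_le_of_le _ fun j hj => ?_))
  · refine ((G r).le_opNorm _).trans ?_
    rw [mul_assoc]
    rw [norm_pow, Real.norm_of_nonneg hs0] at hs1
    refine mul_le_mul (hr0.trans (le_abs_self _)) (hs1.trans ?_) (norm_nonneg _) (abs_nonneg _)
    gcongr
    linarith
  · have := hr2 j hj
    rw [norm_pow, Real.norm_of_nonneg hr0'] at this
    rw [norm_smul, norm_pow, Real.norm_of_nonneg hs0]
    have hN : (s + r) ^ N = (s + r) ^ j * (s + r) ^ (N - j) := by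
      rw [← pow_add, Nat.add_sub_cancel' (Finset.mem_range.1 hj).le]
    calc _ ≤ s ^ j * (C₂ j * r ^ (N - j)) := by gcongr
      _ ≤ (s + r) ^ j * (C₂ j * (s + r) ^ (N - j)) := by
        have := hC₂ j
        gcongr <;> linarith
      _ = _ := by rw [hN]; ring

/-- The diagonal `r = s` of the two-time estimate, regrouped by total degree; the factor `2 ^ N` is
`(s + s) ^ N`. -/
theorem HasExpansion.clm_apply {G : ℝ → E →L[𝕜] F} {C₀ : ℝ}
    (hG : ∀ᶠ s in 𝓝[≥] 0, ‖G s‖ ≤ C₀) {g : ℕ → E → F}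
    (hg : ∀ v, HasExpansion (fun s => G s v) (fun n => g n v)) {h : ℝ → E} {c : ℕ → E}
    (hh : HasExpansion h c) :
    HasExpansion (fun s => G s (h s)) (fun n => ∑ k ∈ Finset.range (n + 1), g (n - k) (c k)) := by
  intro N
  obtain ⟨C, δ, hδ, hC⟩ := exists_norm_apply_sub_sum_le hG hg hh N
  refine IsBigO.of_bound (C * 2 ^ N) ?_
  filter_upwards [Ico_mem_nhdsGE hδ] with s hs
  have h1 := hC s hs s hs
  rw [norm_pow, Real.norm_of_nonneg hs.1]
  refine le_trans (le_of_eq ?_) (h1.trans (le_of_eq ?_))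
  · congr 2
    rw [← Finset.sum_range_diag_flip N fun j i => (s ^ j * s ^ i) • g i (c j)]
    refine Finset.sum_congr rfl fun n _ => ?_
    rw [Finset.smul_sum]
    refine Finset.sum_congr rfl fun k hk => ?_
    rw [← pow_add, Nat.add_sub_cancel' (Nat.lt_succ_iff.1 (Finset.mem_range.1 hk))]
  · rw [← two_mul, mul_pow]; ring

theorem hasExpansion_pow_apply {G : ℝ → E →L[𝕜] E} {C₀ : ℝ}
    (hG : ∀ᶠ s in 𝓝[≥] 0, ‖G s‖ ≤ C₀) {f : PowerSeries (E →L[𝕜] E)}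
    (hg : ∀ v, HasExpansion (fun s => G s v) (fun n => PowerSeries.coeff n f v)) (k : ℕ) (v : E) :
    HasExpansion (fun s => (G s ^ k) v) (fun n => PowerSeries.coeff n (f ^ k) v) := by
  induction k with
  | zero =>
    simp only [pow_zero, PowerSeries.coeff_one, one_apply_eq_self]
    convert! hasExpansion_const v using 2 with n
    split_ifs <;> simp
  | succ k ih =>
    have := ih.clm_apply hG hg
    convert! this using 2 with s n
    · rw [pow_succ']; rfl
    · rw [pow_succ', PowerSeries.coeff_mul, Finset.Nat.sum_antidiagonal_eq_sum_range_succ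
        (fun i j => PowerSeries.coeff i f * PowerSeries.coeff j (f ^ k)),
        ← Finset.sum_range_reflect, _root_.sum_apply]
      refine Finset.sum_congr rfl fun i hi => ?_
      have : i ≤ n := Nat.lt_succ_iff.1 (Finset.mem_range.1 hi)
      rw [show n + 1 - 1 - i = n - i by omega, show n - (n - i) = i by omega]
      rfl

/-- Euler's beta integral at integers. Integration by parts trades a power of `t - s` for a power of
`s`, hence the induction with `j` free. -/
theorem integral_pow_mul_sub_pow (i : ℕ) : ∀ (j : ℕ) (t : ℝ),
    ∫ s in (0 : ℝ)..t, s ^ j * (t - s) ^ i =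
      ((i ! : ℝ) * (j ! : ℝ) / ((i + j + 1)! : ℝ)) * t ^ (i + j + 1) := by
  induction i with
  | zero =>
    intro j t
    simp only [pow_zero, mul_one, integral_pow, zero_add, Nat.factorial_zero, Nat.cast_one, one_mul]
    rw [Nat.factorial_succ, zero_pow (Nat.succ_ne_zero j), sub_zero]
    push_cast
    have : (j ! : ℝ) ≠ 0 := by positivity
    field_simp
  | succ i ih =>
    intro j t
    have hu : ∀ s ∈ uIcc 0 t, HasDerivAt (fun s : ℝ => (t - s) ^ (i + 1))
        (-((i + 1 : ℝ) * (t - s) ^ i)) s := by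
      intro s _
      have := ((hasDerivAt_id s).const_sub t).pow (i + 1)
      refine this.congr_deriv ?_
      simp
    have hv : ∀ s ∈ uIcc 0 t, HasDerivAt (fun s : ℝ => s ^ (j + 1) / (j + 1 : ℝ)) (s ^ j) s := by
      intro s _
      have := (hasDerivAt_pow (j + 1) s).div_const (j + 1 : ℝ)
      refine this.congr_deriv ?_
      have : (j + 1 : ℝ) ≠ 0 := by positivity
      simp [field]
    have := intervalIntegral.integral_mul_deriv_eq_deriv_mul hu hv
      (by apply Continuous.intervalIntegrable; fun_prop)
      (by apply Continuous.intervalIntegrable; fun_prop)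
    simp only [sub_self, zero_pow (Nat.succ_ne_zero _), zero_mul, zero_div, mul_zero, zero_sub] at this
    have e1 : ∀ s : ℝ, -((i + 1 : ℝ) * (t - s) ^ i) * (s ^ (j + 1) / (j + 1 : ℝ)) =
        (-((i + 1 : ℝ) / (j + 1))) * (s ^ (j + 1) * (t - s) ^ i) := fun s => by ring
    simp only [e1] at this
    rw [intervalIntegral.integral_const_mul, ih (j + 1) t] at this
    simp only [mul_comm (_ ^ j)]
    rw [this, show i + (j + 1) + 1 = i + 1 + j + 1 by ring, Nat.factorial_succ i,
      Nat.factorial_succ j]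
    push_cast
    have : ((i + 1 + j + 1)! : ℝ) ≠ 0 := by positivity
    have : (j + 1 : ℝ) ≠ 0 := by positivity
    field_simp

/-- The asymptotic expansion of a convolution. -/
theorem HasExpansion.convolution [CompleteSpace F] {G : ℝ → E →L[𝕜] F} {C₀ : ℝ}
    (hG : ∀ᶠ s in 𝓝[≥] 0, ‖G s‖ ≤ C₀) {g : ℕ → E → F}
    (hg : ∀ v, HasExpansion (fun s => G s v) (fun n => g n v)) {h : ℝ → E} {c : ℕ → E}
    (hh : HasExpansion h c)
    (hint : ∀ t, 0 ≤ t → IntervalIntegrable (fun s => G (t - s) (h s)) MeasureTheory.volume 0 t)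
    {d : ℕ → F} (hd0 : d 0 = 0)
    (hd : ∀ m, d (m + 1) = ∑ k ∈ Finset.range (m + 1),
      (((m - k)! : ℝ) * (k ! : ℝ) / ((m + 1)! : ℝ)) • g (m - k) (c k)) :
    HasExpansion (fun t => ∫ s in (0 : ℝ)..t, G (t - s) (h s)) d := by
  refine HasExpansion.of_succ fun N => ?_
  obtain ⟨C, δ, hδ, hC⟩ := exists_norm_apply_sub_sum_le hG hg hh N
  refine IsBigO.of_bound C ?_
  filter_upwards [Ico_mem_nhdsGE hδ] with t ht
  have ht0 : 0 ≤ t := ht.1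
  -- Integration raises the degree by one, so total degree below `N` gives the partial sum through
  -- `t ^ N`, and `d 0 = 0` supplies the missing constant term.
  have hpoly : ∫ s in (0 : ℝ)..t, ∑ j ∈ Finset.range N, ∑ i ∈ Finset.range (N - j),
      (s ^ j * (t - s) ^ i) • g i (c j) = ∑ n ∈ Finset.range (N + 1), t ^ n • d n := by
    rw [intervalIntegral.integral_finsetSum fun j _ => by
      apply Continuous.intervalIntegrable; fun_prop]
    have : ∀ j ∈ Finset.range N, ∫ s in (0 : ℝ)..t, ∑ i ∈ Finset.range (N - j),
        (s ^ j * (t - s) ^ i) • g i (c j) = ∑ i ∈ Finset.range (N - j),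
        (((i ! : ℝ) * (j ! : ℝ) / ((i + j + 1)! : ℝ)) * t ^ (i + j + 1)) • g i (c j) := by
      intro j _
      rw [intervalIntegral.integral_finsetSum fun i _ => by
        apply Continuous.intervalIntegrable; fun_prop]
      refine Finset.sum_congr rfl fun i _ => ?_
      rw [intervalIntegral.integral_smul_const, integral_pow_mul_sub_pow]
    rw [Finset.sum_congr rfl this, ← Finset.sum_range_diag_flip N fun j i =>
        (((i ! : ℝ) * (j ! : ℝ) / ((i + j + 1)! : ℝ)) * t ^ (i + j + 1)) • g i (c j),
      Finset.sum_range_succ', hd0, smul_zero, add_zero]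
    refine Finset.sum_congr rfl fun n _ => ?_
    rw [hd, Finset.smul_sum]
    refine Finset.sum_congr rfl fun k hk => ?_
    rw [smul_smul, Nat.sub_add_cancel (Nat.lt_succ_iff.1 (Finset.mem_range.1 hk)), mul_comm]
  rw [← hpoly, ← intervalIntegral.integral_sub (hint t ht0)
    (by apply Continuous.intervalIntegrable; fun_prop)]
  have hb : ∀ s ∈ uIoc 0 t, ‖G (t - s) (h s) - ∑ j ∈ Finset.range N, ∑ i ∈ Finset.range (N - j),
      (s ^ j * (t - s) ^ i) • g i (c j)‖ ≤ C * t ^ N := by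
    intro s hs
    rw [uIoc_of_le ht0] at hs
    have := hC s ⟨hs.1.le, hs.2.trans_lt ht.2⟩ (t - s) ⟨by linarith [hs.2], by linarith [hs.1, ht.2]⟩
    rwa [add_sub_cancel] at this
  refine (intervalIntegral.norm_integral_le_of_norm_le_const hb).trans (le_of_eq ?_)
  rw [sub_zero, norm_pow, Real.norm_of_nonneg ht0, abs_of_nonneg ht0, pow_succ, mul_assoc]

end Products

/-! ### From right derivatives to derivatives -/

section RightDerivatives

variable {E : Type*} [NormedAddCommGroup E] [NormedSpace ℝ E]

theorem hasDerivWithinAt_Ici_iff_tendsto {f : ℝ → E} {f' : E} {t : ℝ} :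
    HasDerivWithinAt f f' (Ici t) t ↔
      Tendsto (fun h : ℝ => h⁻¹ • (f (t + h) - f t)) (𝓝[>] 0) (𝓝 f') := by
  rw [← hasDerivWithinAt_Ioi_iff_Ici, hasDerivWithinAt_iff_tendsto_slope' self_notMem_Ioi]
  have : 𝓝[>] t = map (fun h => t + h) (𝓝[>] 0) := by rw [map_add_left_nhdsGT, add_zero]
  rw [this, tendsto_map'_iff]
  refine tendsto_congr fun h => ?_
  simp [slope, Function.comp_apply]

/-- A continuous function with a continuous right derivative is differentiable. -/
theorem hasDerivWithinAt_Ici_zero_of_right [CompleteSpace E] {f g : ℝ → E}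
    (hf : ContinuousOn f (Ici 0)) (hg : ContinuousOn g (Ici 0))
    (hd : ∀ t, 0 ≤ t → HasDerivWithinAt f (g t) (Ici t) t) (t : ℝ) (ht : 0 ≤ t) :
    HasDerivWithinAt f (g t) (Ici 0) t := by
  -- Freezing `g` at its value at `0` on the negative axis gives a continuous function on the line,
  -- to which the two-sided fundamental theorem applies.
  have hgc : Continuous fun s : ℝ => g (max s 0) :=
    hg.comp_continuous (by fun_prop) fun s => mem_Ici.2 (le_max_right _ _)
  have h1 : ∀ τ ∈ Ici (0 : ℝ), f τ = f 0 + ∫ s in (0 : ℝ)..τ, g (max s 0) := by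
    intro τ hτ
    rw [intervalIntegral.integral_eq_sub_of_hasDeriv_right_of_le hτ
      (hf.mono Icc_subset_Ici_self) (fun s hs => ?_) (hgc.intervalIntegrable _ _)]
    · abel
    · simp only [max_eq_left hs.1.le]
      exact hasDerivWithinAt_Ioi_iff_Ici.2 (hd s hs.1.le)
  have h2 := ((hgc.integral_hasStrictDerivAt 0 t).hasDerivAt.const_add (f 0)).hasDerivWithinAt
    (s := Ici 0)
  simp only [max_eq_left ht] at h2
  exact h2.congr h1 (h1 t ht)

end RightDerivatives

/-! ### Strongly continuous semigroups and variation of constants -/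

section Semigroups

variable {𝕜 X : Type*} [RCLike 𝕜] [NormedAddCommGroup X] [NormedSpace 𝕜 X]

theorem IsC0Semigroup.exists_norm_le [CompleteSpace X] {T : ℝ → X →L[𝕜] X}
    (hT : IsC0Semigroup T) (t : ℝ) : ∃ C : ℝ, ∀ s ∈ Icc 0 t, ‖T s‖ ≤ C := by
  have : ∀ x : X, ∃ C, ∀ s : Icc 0 t, ‖T s x‖ ≤ C := fun x => by
    obtain ⟨C, hC⟩ := isCompact_Icc.exists_bound_of_continuousOn
      ((hT.continuousOn x).mono (Icc_subset_Ici_self : Icc 0 t ⊆ Ici 0))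
    exact ⟨C, fun s => hC s s.2⟩
  obtain ⟨C, hC⟩ := banach_steinhaus this
  exact ⟨C, fun s hs => hC ⟨s, hs⟩⟩

/-- Joint continuity: strong continuity handles the fixed vector, and the uniform bound on compact
time intervals handles the moving one. -/
theorem IsC0Semigroup.tendsto_apply [CompleteSpace X] {T : ℝ → X →L[𝕜] X}
    (hT : IsC0Semigroup T) {α : Type*} {l : Filter α} {f : α → ℝ} {u : α → X} {t : ℝ} {x : X}
    (ht : 0 ≤ t) (hf : Tendsto f l (𝓝[Ici 0] t)) (hu : Tendsto u l (𝓝 x)) :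
    Tendsto (fun a => T (f a) (u a)) l (𝓝 (T t x)) := by
  obtain ⟨C, hC⟩ := hT.exists_norm_le (t + 1)
  have h1 : Tendsto (fun a => T (f a) x) l (𝓝 (T t x)) := (hT.continuousOn x t ht).tendsto.comp hf
  have h2 : Tendsto (fun a => T (f a) (u a - x)) l (𝓝 0) := by
    have hux : Tendsto (fun a => C * ‖u a - x‖) l (𝓝 0) := by
      have := ((hu.sub_const x).norm.const_mul C)
      simpa using this
    refine squeeze_zero_norm' ?_ hux
    have hmem : Icc 0 (t + 1) ∈ 𝓝[Ici 0] t := by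
      filter_upwards [self_mem_nhdsWithin, mem_nhdsWithin_of_mem_nhds
        (Iic_mem_nhds (lt_add_one t))] with s hs hs'
      exact ⟨hs, hs'⟩
    filter_upwards [hf hmem] with a ha
    exact (T (f a)).le_of_opNorm_le (hC _ ha) _
  have := h1.add h2
  rw [add_zero] at this
  refine this.congr fun a => ?_
  rw [map_sub]; abel

theorem IsC0Semigroup.continuousOn_apply [CompleteSpace X] {T : ℝ → X →L[𝕜] X}
    (hT : IsC0Semigroup T) {α : Type*} [TopologicalSpace α] {s : Set α} {f : α → ℝ} {u : α → X}
    (hf : ContinuousOn f s) (hf0 : MapsTo f s (Ici 0)) (hu : ContinuousOn u s) :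
    ContinuousOn (fun a => T (f a) (u a)) s := fun a ha =>
  hT.tendsto_apply (hf0 ha) ((hf a ha).tendsto_nhdsWithin hf0) (hu a ha)

variable [NormedSpace ℝ X]

/-- Only the point `T t x` has to lie in the domain, not `x`. This suits the orthogonal orbit, whose
points are assumed to lie in `D(L)`. -/
theorem IsGenerator.hasDerivWithinAt_of_apply_mem {T : ℝ → X →L[𝕜] X} {A : X →ₗ.[𝕜] X}
    (hA : IsGenerator A T) (hT : IsC0Semigroup T) {x y : X} {t : ℝ}
    (hxy : (T t x, y) ∈ A.graph) (ht : 0 ≤ t) :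
    HasDerivWithinAt (fun s => T s x) y (Ici t) t := by
  rw [hasDerivWithinAt_Ici_iff_tendsto]
  refine ((hA _ _).1 hxy).congr' ?_
  filter_upwards [self_mem_nhdsWithin] with h hh
  have hh' : (0 : ℝ) < h := hh
  rw [add_comm t h, hT.map_add h t hh'.le ht]
  rfl

variable [IsScalarTower ℝ 𝕜 X]

theorem IsGenerator.hasDerivWithinAt {T : ℝ → X →L[𝕜] X} {A : X →ₗ.[𝕜] X}
    (hA : IsGenerator A T) (hT : IsC0Semigroup T) {x y : X} (hxy : (x, y) ∈ A.graph) {t : ℝ}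
    (ht : 0 ≤ t) : HasDerivWithinAt (fun s => T s x) (T t y) (Ici t) t := by
  rw [hasDerivWithinAt_Ici_iff_tendsto]
  have := ((T t).continuous.tendsto y).comp ((hA x y).1 hxy)
  refine this.congr' ?_
  filter_upwards [self_mem_nhdsWithin] with h hh
  have hh' : (0 : ℝ) < h := hh
  rw [Function.comp_apply, ContinuousLinearMap.map_smul_of_tower, map_sub, hT.map_add t h ht hh'.le]
  rfl

/-- The right derivative of `s ↦ e^{(t-s)A} u(s)`. -/
theorem IsGenerator.hasDerivWithinAt_sub_apply [CompleteSpace X] {T : ℝ → X →L[𝕜] X}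
    {A : X →ₗ.[𝕜] X} (hA : IsGenerator A T) (hT : IsC0Semigroup T) {u : ℝ → X} {s t : ℝ}
    {u' v : X} (hu : HasDerivWithinAt u u' (Ici s) s) (hv : (u s, v) ∈ A.graph) (hst : s < t) :
    HasDerivWithinAt (fun r => T (t - r) (u r)) (T (t - s) (u' - v)) (Ici s) s := by
  rw [hasDerivWithinAt_Ici_iff_tendsto] at hu ⊢
  have h1 := hu.sub ((hA _ _).1 hv)
  have hts : 0 < t - s := sub_pos.2 hst
  have hf : Tendsto (fun h : ℝ => t - (s + h)) (𝓝[>] 0) (𝓝[Ici 0] (t - s)) := by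
    refine tendsto_nhdsWithin_iff.2 ⟨?_, ?_⟩
    · have : Tendsto (fun h : ℝ => t - (s + h)) (𝓝 0) (𝓝 (t - (s + 0))) :=
        Continuous.tendsto (by fun_prop) 0
      rw [add_zero] at this
      exact this.mono_left nhdsWithin_le_nhds
    · filter_upwards [mem_nhdsWithin_of_mem_nhds (Iio_mem_nhds hts)] with h hh
      have : h < t - s := hh
      rw [mem_Ici]; linarith
  refine (hT.tendsto_apply hts.le hf h1).congr' ?_
  filter_upwards [self_mem_nhdsWithin, mem_nhdsWithin_of_mem_nhds (Iio_mem_nhds hts)] with h hh hh2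
  have hh' : (0 : ℝ) < h := hh
  have hh2' : h < t - s := hh2
  -- Factoring out `T (t - (s + h))` leaves the difference quotient of `u` minus that of the
  -- semigroup at `u s`.
  have e : T (t - s) = T (t - (s + h)) * T h := by
    rw [← hT.map_add _ _ (by linarith) hh'.le]; congr 1; ring
  rw [← smul_sub, ContinuousLinearMap.map_smul_of_tower, e, sub_sub_sub_cancel_right, map_sub]
  rfl

/-- The variation of constants formula. -/
theorem IsGenerator.variation_of_constants [CompleteSpace X] {T : ℝ → X →L[𝕜] X}
    {A : X →ₗ.[𝕜] X} (hA : IsGenerator A T) (hT : IsC0Semigroup T) {u u' v : ℝ → X} {t : ℝ}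
    (ht : 0 ≤ t) (huc : ContinuousOn u (Icc 0 t))
    (hu : ∀ s ∈ Ico 0 t, HasDerivWithinAt u (u' s) (Ici s) s)
    (hv : ∀ s ∈ Ico 0 t, (u s, v s) ∈ A.graph)
    (hint : IntervalIntegrable (fun s => T (t - s) (u' s - v s)) MeasureTheory.volume 0 t) :
    ∫ s in (0 : ℝ)..t, T (t - s) (u' s - v s) = u t - T t (u 0) := by
  have hc : ContinuousOn (fun r => T (t - r) (u r)) (Icc 0 t) :=
    hT.continuousOn_apply (by fun_prop) (fun r hr => sub_nonneg.2 hr.2) huc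
  rw [intervalIntegral.integral_eq_sub_of_hasDeriv_right_of_le ht hc (fun s hs =>
    hasDerivWithinAt_Ioi_iff_Ici.2 (hA.hasDerivWithinAt_sub_apply hT (hu s ⟨hs.1.le, hs.2⟩)
      (hv s ⟨hs.1.le, hs.2⟩) hs.2)) hint]
  simp [hT.map_zero]

end Semigroups

/-! ### Closures, and boundedness of `L^j P` -/

section UnboundedOperators

variable {𝕜 X : Type*} [RCLike 𝕜] [NormedAddCommGroup X] [NormedSpace 𝕜 X]

theorem mem_graph_totalApply (A : X →ₗ.[𝕜] X) {x : X} (hx : x ∈ A.domain) :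
    (x, totalApply A x) ∈ A.graph := by
  rw [totalApply, dif_pos hx]
  exact A.mem_graph ⟨x, hx⟩

/-- The continuous map `(x, y) ↦ (x, Q y)` sends one graph into the other, hence closure into
closure. -/
theorem mem_closure_leftComp_graph {Q : X →L[𝕜] X} {A : X →ₗ.[𝕜] X} (hA : A.IsClosable)
    (hQA : (leftComp Q A).IsClosable) {x y : X} (h : (x, y) ∈ A.closure.graph) :
    (x, Q y) ∈ (leftComp Q A).closure.graph := by
  rw [← hA.graph_closure_eq_closure_graph] at h
  rw [← hQA.graph_closure_eq_closure_graph]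
  have hc : Continuous fun p : X × X => (p.1, Q p.2) := by fun_prop
  have key : MapsTo (fun p : X × X => (p.1, Q p.2)) (A.graph : Set (X × X))
      ((leftComp Q A).graph : Set (X × X)) := fun p hp => by
    obtain ⟨y, hy1, hy2⟩ := (LinearPMap.mem_graph_iff A).1 hp
    exact (LinearPMap.mem_graph_iff _).2 ⟨y, hy1, congrArg Q hy2⟩
  have h' : (x, y) ∈ _root_.closure (A.graph : Set (X × X)) := h
  exact key.closure hc h'

theorem powProj_zero (A : X →ₗ.[𝕜] X) (P : X →L[𝕜] X)
    (hP : LinearMap.range (P : X →ₗ[𝕜] X) ≤ smoothDomain A) (x : X) :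
    powProj A P hP 0 x = P x := rfl

theorem powProj_succ_mem_graph (A : X →ₗ.[𝕜] X) (P : X →L[𝕜] X)
    (hP : LinearMap.range (P : X →ₗ[𝕜] X) ≤ smoothDomain A) (j : ℕ) (x : X) :
    (powProj A P hP j x, powProj A P hP (j + 1) x) ∈ A.graph := by
  rw [LinearPMap.mem_graph_iff]
  refine ⟨⟨powProj A P hP j x, smoothDomain_le A (Subtype.property _)⟩, rfl, ?_⟩
  simp only [powProj, pow_succ']
  rfl

/-- Closed graph theorem, inductively: if `L^j P` is continuous and `L` is closed, then `L^{j+1} P`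
has closed graph and is everywhere defined. -/
theorem continuous_powProj [CompleteSpace X] {A : X →ₗ.[𝕜] X} (hA : A.IsClosed) (P : X →L[𝕜] X)
    (hP : LinearMap.range (P : X →ₗ[𝕜] X) ≤ smoothDomain A) (j : ℕ) :
    Continuous (powProj A P hP j) := by
  induction j with
  | zero => exact P.continuous
  | succ j ih =>
    refine LinearMap.continuous_of_seq_closed_graph _ fun u x y hu hy => ?_
    have h1 : Tendsto (fun n => (powProj A P hP j (u n), powProj A P hP (j + 1) (u n))) atTop
        (𝓝 (powProj A P hP j x, y)) := ((ih.tendsto x).comp hu).prodMk_nhds hy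
    have h2 : (powProj A P hP j x, y) ∈ A.graph :=
      hA.mem_of_tendsto h1 (Eventually.of_forall fun n => powProj_succ_mem_graph A P hP j (u n))
    exact LinearPMap.mem_graph_snd_inj A h2 (powProj_succ_mem_graph A P hP j x) rfl

end UnboundedOperators

/-! ### Dyson's identity -/

section Dyson

variable {𝕜 X : Type*} [RCLike 𝕜] [NormedAddCommGroup X] [NormedSpace 𝕜 X] [NormedSpace ℝ X]

/-- A closed operator `L` generating a semigroup `T`, such that `Q L` generates `S`, together with
the time regularity of the memory kernel. -/
structure ProjectedDynamics (P Q : X →L[𝕜] X) (L : X →ₗ.[𝕜] X) (T S : ℝ → X →L[𝕜] X)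
    (hP : LinearMap.range (P : X →ₗ[𝕜] X) ≤ smoothDomain L.closure) : Prop where
  add_eq_one : P + Q = 1
  mul_eq_zero : P * Q = 0
  generates : ClosureGenerates L T
  generates_leftComp : ClosureGenerates (leftComp Q L) S
  mem_domain : ∀ s : ℝ, 0 ≤ s → ∀ x : X, S s (Q (powProj L.closure P hP 1 x)) ∈ L.closure.domain
  contDiffOn : ∀ x : X,
    ContDiffOn ℝ ∞ (fun s => memoryKernel L.closure P Q hP S s x) (Ici 0)

namespace ProjectedDynamics

variable {P Q : X →L[𝕜] X} {L : X →ₗ.[𝕜] X} {T S : ℝ → X →L[𝕜] X}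
    {hP : LinearMap.range (P : X →ₗ[𝕜] X) ≤ smoothDomain L.closure}

theorem apply_add_apply (h : ProjectedDynamics P Q L T S hP) (x : X) : P x + Q x = x :=
  DFunLike.congr_fun h.add_eq_one x

theorem proj_compl_apply (h : ProjectedDynamics P Q L T S hP) (x : X) : P (Q x) = 0 :=
  DFunLike.congr_fun h.mul_eq_zero x

theorem proj_proj_apply (h : ProjectedDynamics P Q L T S hP) (x : X) : P (P x) = P x := by
  conv_rhs => rw [← h.apply_add_apply x, map_add, h.proj_compl_apply, add_zero]

theorem isSemigroup (h : ProjectedDynamics P Q L T S hP) : IsC0Semigroup T :=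
  h.generates.isSemigroup

theorem isGenerator (h : ProjectedDynamics P Q L T S hP) : IsGenerator L.closure T :=
  h.generates.isGenerator

theorem continuousOn_memoryKernel (h : ProjectedDynamics P Q L T S hP) (x : X) :
    ContinuousOn (fun s => memoryKernel L.closure P Q hP S s x) (Ici 0) :=
  (h.contDiffOn x).continuousOn

theorem proj_memoryKernel (h : ProjectedDynamics P Q L T S hP) (s : ℝ) (x : X) :
    P (memoryKernel L.closure P Q hP S s x) = memoryKernel L.closure P Q hP S s x :=
  h.proj_proj_apply _

theorem hasDerivWithinAt_orthogonal (h : ProjectedDynamics P Q L T S hP) (x : X) {s : ℝ}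
    (hs : 0 ≤ s) :
    HasDerivWithinAt (fun s => S s (Q (powProj L.closure P hP 1 x)))
      (Q (totalApply L.closure (S s (Q (powProj L.closure P hP 1 x))))) (Ici s) s :=
  h.generates_leftComp.isGenerator.hasDerivWithinAt_of_apply_mem h.generates_leftComp.isSemigroup
    (mem_closure_leftComp_graph h.generates.isClosable h.generates_leftComp.isClosable
      (mem_graph_totalApply _ (h.mem_domain s hs x))) hs

theorem continuousOn_convolution [CompleteSpace X] (h : ProjectedDynamics P Q L T S hP) (t : ℝ) {u : ℝ → X}
    (hu : ContinuousOn u (Ici 0)) : ContinuousOn (fun s => T (t - s) (u s)) (Icc 0 t) :=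
  h.isSemigroup.continuousOn_apply (by fun_prop) (fun s hs => sub_nonneg.2 hs.2)
    (hu.mono Icc_subset_Ici_self)

theorem intervalIntegrable_convolution [CompleteSpace X] (h : ProjectedDynamics P Q L T S hP) {t : ℝ} (ht : 0 ≤ t)
    {u : ℝ → X} (hu : ContinuousOn u (Ici 0)) :
    IntervalIntegrable (fun s => T (t - s) (u s)) MeasureTheory.volume 0 t :=
  (h.continuousOn_convolution t hu).intervalIntegrable_of_Icc ht

theorem intervalIntegrable_map_convolution [CompleteSpace X] {E : Type*} [NormedAddCommGroup E] [NormedSpace 𝕜 E]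
    (h : ProjectedDynamics P Q L T S hP) (B : X →L[𝕜] E) {t : ℝ}
    (ht : 0 ≤ t) {u : ℝ → X} (hu : ContinuousOn u (Ici 0)) :
    IntervalIntegrable (fun s => B (T (t - s) (u s))) MeasureTheory.volume 0 t :=
  (B.continuous.comp_continuousOn (h.continuousOn_convolution t hu)).intervalIntegrable_of_Icc ht

variable [IsScalarTower ℝ 𝕜 X]

/-- The right derivative of the orbit lies in `Ran Q`, which `P` annihilates; so its image under `P`
is constant, and it starts at zero. -/
theorem proj_orthogonal (h : ProjectedDynamics P Q L T S hP) (x : X) {t : ℝ} (ht : 0 ≤ t) :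
    P (S t (Q (powProj L.closure P hP 1 x))) = 0 := by
  have hc : ContinuousOn (fun s => P (S s (Q (powProj L.closure P hP 1 x)))) (Icc 0 t) :=
    P.continuous.comp_continuousOn
      ((h.generates_leftComp.isSemigroup.continuousOn _).mono Icc_subset_Ici_self)
  have hd : ∀ s ∈ Ico 0 t, HasDerivWithinAt
      (fun s => P (S s (Q (powProj L.closure P hP 1 x)))) 0 (Ici s) s := fun s hs => by
    have := (P.restrictScalars ℝ).hasFDerivAt.comp_hasDerivWithinAt s
      (h.hasDerivWithinAt_orthogonal x hs.1)
    refine this.congr_deriv ?_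
    exact h.proj_compl_apply _
  have := constant_of_has_deriv_right_zero hc hd t ⟨ht, le_rfl⟩
  rw [this, h.generates_leftComp.isSemigroup.map_zero]
  exact h.proj_compl_apply _

theorem hasExpansion_semigroup (h : ProjectedDynamics P Q L T S hP) (j : ℕ) (x : X) :
    HasExpansion (fun s => T s (powProj L.closure P hP j x))
      (fun n => ((n ! : ℝ)⁻¹) • powProj L.closure P hP (j + n) x) := by
  have := hasExpansion_of_hasDerivWithinAt
    (u := fun n s => T s (powProj L.closure P hP (j + n) x))
    (fun n => h.isSemigroup.continuousOn _) fun n s hs =>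
      h.isGenerator.hasDerivWithinAt h.isSemigroup (powProj_succ_mem_graph _ P hP (j + n) x) hs
  simpa only [h.isSemigroup.map_zero, one_apply_eq_self, add_zero] using this

variable [CompleteSpace X]

/-- Dyson's identity for the orthogonal dynamics. -/
theorem apply_eq_orthogonal_add_integral (h : ProjectedDynamics P Q L T S hP) (x : X) {t : ℝ}
    (ht : 0 ≤ t) :
    T t (Q (powProj L.closure P hP 1 x)) = S t (Q (powProj L.closure P hP 1 x)) +
      ∫ s in (0 : ℝ)..t, T (t - s) (memoryKernel L.closure P Q hP S s x) := by
  -- Since `Q - 1 = -P`, the source term in variation of constants is minus the memory kernel.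
  have e : ∀ s, Q (totalApply L.closure (S s (Q (powProj L.closure P hP 1 x)))) -
      totalApply L.closure (S s (Q (powProj L.closure P hP 1 x))) =
      - memoryKernel L.closure P Q hP S s x := fun s => by
    rw [memoryKernel, sub_eq_iff_eq_add, eq_neg_add_iff_add_eq]
    exact h.apply_add_apply _
  have := h.isGenerator.variation_of_constants h.isSemigroup ht
    ((h.generates_leftComp.isSemigroup.continuousOn _).mono Icc_subset_Ici_self)
    (fun s hs => h.hasDerivWithinAt_orthogonal x hs.1)
    (fun s hs => mem_graph_totalApply _ (h.mem_domain s hs.1 x)) (by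
      simp only [e, map_neg]
      exact (h.intervalIntegrable_convolution ht (h.continuousOn_memoryKernel x)).neg)
  simp only [e, map_neg, intervalIntegral.integral_neg] at this
  rw [h.generates_leftComp.isSemigroup.map_zero, one_apply_eq_self] at this
  rw [← sub_eq_iff_eq_add', ← neg_sub, ← this, neg_neg]

/-- Any `B` that vanishes on `ker P` removes the orthogonal orbit. It is used for `P` itself and for
`P` regarded as a map into `V`. -/
theorem map_proj_apply_eq_integral {E : Type*} [NormedAddCommGroup E] [NormedSpace 𝕜 E]
    [NormedSpace ℝ E] [CompleteSpace E] (h : ProjectedDynamics P Q L T S hP) (B : X →L[𝕜] E)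
    (hB : ∀ x, P x = 0 → B x = 0) (x : X) {t : ℝ} (ht : 0 ≤ t) :
    B (T t (Q (powProj L.closure P hP 1 x))) =
      ∫ s in (0 : ℝ)..t, B (T (t - s) (memoryKernel L.closure P Q hP S s x)) := by
  rw [h.apply_eq_orthogonal_add_integral x ht, map_add, hB _ (h.proj_orthogonal x ht), zero_add,
    ContinuousLinearMap.intervalIntegral_comp_comm]
  exact h.intervalIntegrable_convolution ht (h.continuousOn_memoryKernel x)

/-- Split `LPx = PLPx + QLPx` in the derivative `P e^{tL} LPx`; Dyson's identity rewrites the second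
part as the memory integral. -/
theorem hasDerivWithinAt_proj (h : ProjectedDynamics P Q L T S hP) (x : X) {t : ℝ} (ht : 0 ≤ t) :
    HasDerivWithinAt (fun τ => P (T τ (P x)))
      (P (T t (P (powProj L.closure P hP 1 x))) +
        ∫ s in (0 : ℝ)..t, P (T (t - s) (memoryKernel L.closure P Q hP S s x))) (Ici 0) t := by
  rw [← h.map_proj_apply_eq_integral P (fun x hx => hx) x ht, ← map_add, ← map_add,
    h.apply_add_apply]
  refine hasDerivWithinAt_Ici_zero_of_right
    (g := fun t => P (T t (powProj L.closure P hP 1 x)))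
    (P.continuous.comp_continuousOn (h.isSemigroup.continuousOn _))
    (P.continuous.comp_continuousOn (h.isSemigroup.continuousOn _)) (fun s hs => ?_) t ht
  exact (P.restrictScalars ℝ).hasFDerivAt.comp_hasDerivWithinAt s
    (h.isGenerator.hasDerivWithinAt h.isSemigroup (powProj_succ_mem_graph _ P hP 0 x) hs)

end ProjectedDynamics

end Dyson

/-! ### Bounded operators on `V` -/

section Compression

variable {𝕜 X : Type*} [RCLike 𝕜] [NormedAddCommGroup X] [NormedSpace 𝕜 X]

/-- The inclusion of the continuous endomorphisms into the endomorphisms. -/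
def toEnd (𝕜 V : Type*) [RCLike 𝕜] [NormedAddCommGroup V] [NormedSpace 𝕜 V] :
    (V →L[𝕜] V) →ₐ[𝕜] Module.End 𝕜 V :=
  { ContinuousLinearMap.toLinearMapRingHom with commutes' := fun _ => rfl }

theorem toEnd_apply {V : Type*} [NormedAddCommGroup V] [NormedSpace 𝕜 V] (f : V →L[𝕜] V) (v : V) :
    toEnd 𝕜 V f v = f v := rfl

/-- `P` as a map to a subspace containing its range. -/
def toRange (P : X →L[𝕜] X) (V : Submodule 𝕜 X)
    (hV : LinearMap.range (P : X →ₗ[𝕜] X) ≤ V) : X →L[𝕜] V :=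
  P.codRestrict V (fun x => hV ⟨x, rfl⟩)

theorem coe_toRange_apply (P : X →L[𝕜] X) (V : Submodule 𝕜 X)
    (hV : LinearMap.range (P : X →ₗ[𝕜] X) ≤ V) (x : X) : (toRange P V hV x : X) = P x := rfl

/-- The continuous operator `(P M)|_V : V → V`. -/
def compress (P : X →L[𝕜] X) (V : Submodule 𝕜 X)
    (hV : LinearMap.range (P : X →ₗ[𝕜] X) ≤ V) (M : X →L[𝕜] X) : V →L[𝕜] V :=
  (toRange P V hV).comp (M.comp V.subtypeL)

theorem compress_apply (P : X →L[𝕜] X) (V : Submodule 𝕜 X)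
    (hV : LinearMap.range (P : X →ₗ[𝕜] X) ≤ V) (M : X →L[𝕜] X) (v : V) :
    compress P V hV M v = toRange P V hV (M v) := rfl

theorem norm_compress_le (P : X →L[𝕜] X) (V : Submodule 𝕜 X)
    (hV : LinearMap.range (P : X →ₗ[𝕜] X) ≤ V) (M : X →L[𝕜] X) :
    ‖compress P V hV M‖ ≤ ‖P‖ * ‖M‖ := by
  refine ContinuousLinearMap.opNorm_le_bound _ (by positivity) fun v => ?_
  rw [mul_assoc]
  exact P.le_opNorm_of_le (M.le_opNorm v)

/-- The continuous operator `(P e^{sL} P)|_V : V → V`. -/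
def evolution (T : ℝ → X →L[𝕜] X) (P : X →L[𝕜] X) (V : Submodule 𝕜 X)
    (hV : LinearMap.range (P : X →ₗ[𝕜] X) ≤ V) (s : ℝ) : V →L[𝕜] V :=
  compress P V hV (T s * P)

theorem toEnd_evolution (T : ℝ → X →L[𝕜] X) (P : X →L[𝕜] X) (V : Submodule 𝕜 X)
    (hV : LinearMap.range (P : X →ₗ[𝕜] X) ≤ V) (s : ℝ) :
    toEnd 𝕜 V (evolution T P V hV s) = projEvolution T P V hV s := rfl

theorem continuous_moment [CompleteSpace X] {A : X →ₗ.[𝕜] X} (hA : A.IsClosed) (P : X →L[𝕜] X)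
    (hP : LinearMap.range (P : X →ₗ[𝕜] X) ≤ smoothDomain A) (V : Submodule 𝕜 X)
    (hV : LinearMap.range (P : X →ₗ[𝕜] X) ≤ V) (j : ℕ) : Continuous (moment A P hP V hV j) :=
  (toRange P V hV).continuous.comp ((continuous_powProj hA P hP j).comp continuous_subtype_val)

/-- An inverse of a continuous operator is continuous, as soon as the space is complete. -/
theorem continuous_of_mul_eq_one {V : Type*} [NormedAddCommGroup V] [NormedSpace 𝕜 V]
    [CompleteSpace V] {f g : Module.End 𝕜 V} (hf : Continuous f) (hfg : f * g = 1)
    (hgf : g * f = 1) : Continuous g := by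
  refine LinearMap.continuous_of_seq_closed_graph g fun u x y hu hy => ?_
  have h1 : ∀ x, f (g x) = x := fun x => DFunLike.congr_fun hfg x
  have h2 : ∀ x, g (f x) = x := fun x => DFunLike.congr_fun hgf x
  have h3 : Tendsto (fun n => f (g (u n))) atTop (𝓝 (f y)) := (hf.tendsto y).comp hy
  simp only [h1] at h3
  rw [tendsto_nhds_unique hu h3, h2]

theorem moment_zero {A : X →ₗ.[𝕜] X} {P : X →L[𝕜] X}
    {hP : LinearMap.range (P : X →ₗ[𝕜] X) ≤ smoothDomain A} {V : Submodule 𝕜 X}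
    {hV : LinearMap.range (P : X →ₗ[𝕜] X) ≤ V} (hVP : ∀ v : V, P v = v) : moment A P hP V hV 0 = 1 := by
  ext v
  change P (P v) = v
  rw [hVP, hVP]

/-- The memory kernel as a map to `V`. -/
noncomputable def kernelOn (L : X →ₗ.[𝕜] X) (P Q : X →L[𝕜] X) (S : ℝ → X →L[𝕜] X)
    (hP : LinearMap.range (P : X →ₗ[𝕜] X) ≤ smoothDomain L.closure) (V : Submodule 𝕜 X)
    (hV : LinearMap.range (P : X →ₗ[𝕜] X) ≤ V) (s : ℝ) (x : X) : V :=
  toRange P V hV (memoryKernel L.closure P Q hP S s x)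

end Compression

namespace ProjectedDynamics

variable {𝕜 X : Type*} [RCLike 𝕜] [NormedAddCommGroup X] [NormedSpace 𝕜 X] [NormedSpace ℝ X]
  {P Q : X →L[𝕜] X} {L : X →ₗ.[𝕜] X} {T S : ℝ → X →L[𝕜] X}
  {hP : LinearMap.range (P : X →ₗ[𝕜] X) ≤ smoothDomain L.closure}
  {V : Submodule 𝕜 X} {hV : LinearMap.range (P : X →ₗ[𝕜] X) ≤ V}

theorem exists_norm_evolution_le [CompleteSpace X] (h : ProjectedDynamics P Q L T S hP) :
    ∃ C : ℝ, ∀ᶠ s in 𝓝[≥] 0, ‖evolution T P V hV s‖ ≤ C := by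
  obtain ⟨C, hC⟩ := h.isSemigroup.exists_norm_le 1
  refine ⟨‖P‖ * (C * ‖P‖), ?_⟩
  filter_upwards [Icc_mem_nhdsGE (zero_lt_one' ℝ)] with s hs
  refine (norm_compress_le _ _ _ _).trans ?_
  gcongr
  refine (norm_mul_le _ _).trans ?_
  gcongr
  exact hC s hs

theorem continuousOn_evolution_apply [CompleteSpace X] (h : ProjectedDynamics P Q L T S hP)
    {u : ℝ → V} (hu : ContinuousOn u (Ici 0)) :
    ContinuousOn (fun s => evolution T P V hV s (u s)) (Ici 0) :=
  (toRange P V hV).continuous.comp_continuousOn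
    (h.isSemigroup.continuousOn_apply continuousOn_id (fun _ hs => hs)
      (P.continuous.comp_continuousOn (continuous_subtype_val.comp_continuousOn hu)))

theorem continuousOn_evolution_pow_apply [CompleteSpace X] (h : ProjectedDynamics P Q L T S hP)
    (k : ℕ) (v : V) : ContinuousOn (fun s => (evolution T P V hV s ^ k) v) (Ici 0) := by
  induction k with
  | zero => exact continuousOn_const
  | succ k ih =>
    simp only [pow_succ']
    exact h.continuousOn_evolution_apply (hV := hV) ih

theorem coe_kernelOn (h : ProjectedDynamics P Q L T S hP) (s : ℝ) (x : X) :
    (kernelOn L P Q S hP V hV s x : X) = memoryKernel L.closure P Q hP S s x :=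
  h.proj_memoryKernel s x

variable [IsScalarTower ℝ 𝕜 X]

theorem hasExpansion_evolution (h : ProjectedDynamics P Q L T S hP) (v : V) :
    HasExpansion (fun s => evolution T P V hV s v)
      (fun n => ((n ! : ℝ)⁻¹) • moment L.closure P hP V hV n v) := by
  have := (h.hasExpansion_semigroup 0 v).map (toRange P V hV)
  simp only [zero_add, ContinuousLinearMap.map_smul_of_tower] at this
  exact this

theorem exists_hasExpansion_kernelOn (h : ProjectedDynamics P Q L T S hP) (x : X) :
    ∃ c : ℕ → V, HasExpansion (fun s => kernelOn L P Q S hP V hV s x) c := by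
  obtain ⟨c, hc⟩ := hasExpansion_of_contDiffOn (h.contDiffOn x)
  exact ⟨_, hc.map (toRange P V hV)⟩

end ProjectedDynamics

theorem powProj_proj {𝕜 X : Type*} [RCLike 𝕜] [NormedAddCommGroup X] [NormedSpace 𝕜 X]
    (A : X →ₗ.[𝕜] X) (P : X →L[𝕜] X)
    (hP : LinearMap.range (P : X →ₗ[𝕜] X) ≤ smoothDomain A) (hPP : ∀ x, P (P x) = P x) (j : ℕ)
    (x : X) : powProj A P hP j (P x) = powProj A P hP j x := by
  have : (⟨P (P x), hP ⟨P x, rfl⟩⟩ : smoothDomain A) = ⟨P x, hP ⟨x, rfl⟩⟩ := Subtype.ext (hPP x)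
  exact congrArg (fun y => (((smoothEnd A ^ j) y : smoothDomain A) : X)) this

/-- Convolution with a sequence starting with `a 0 = 1` is unitriangular, hence injective. -/
theorem eq_of_sum_mul_eq {𝕜 V : Type*} [RCLike 𝕜] [NormedAddCommGroup V] [NormedSpace 𝕜 V]
    {a : ℕ → V →L[𝕜] V} (ha : a 0 = 1) {y z : ℕ → V}
    (h : ∀ m, ∑ k ∈ Finset.range (m + 1), a (m - k) (y k) =
      ∑ k ∈ Finset.range (m + 1), a (m - k) (z k)) (m : ℕ) : y m = z m := by
  induction m using Nat.strong_induction_on with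
  | _ m ih =>
    have := h m
    rw [Finset.sum_range_succ, Finset.sum_range_succ, Nat.sub_self, ha,
      Finset.sum_congr rfl fun k hk => by rw [ih k (Finset.mem_range.1 hk)]] at this
    exact add_left_cancel this

theorem natCast_inv_smul {𝕜 E : Type*} [RCLike 𝕜] [NormedAddCommGroup E] [NormedSpace 𝕜 E]
    [NormedSpace ℝ E] [IsScalarTower ℝ 𝕜 E] (n : ℕ) (x : E) :
    ((n : ℝ)⁻¹) • x = ((n : 𝕜)⁻¹) • x := by
  rw [RCLike.real_smul_eq_coe_smul (K := 𝕜)]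
  simp

theorem toRange_powProj {𝕜 X : Type*} [RCLike 𝕜] [NormedAddCommGroup X] [NormedSpace 𝕜 X]
    {P : X →L[𝕜] X} {L : X →ₗ.[𝕜] X}
    {hP : LinearMap.range (P : X →ₗ[𝕜] X) ≤ smoothDomain L.closure}
    {V : Submodule 𝕜 X} {hV : LinearMap.range (P : X →ₗ[𝕜] X) ≤ V} {a : ℕ → V →L[𝕜] V}
    (ha : ∀ j, toEnd 𝕜 V (a j) = moment L.closure P hP V hV j) (j : ℕ)
    (v : V) : toRange P V hV (powProj L.closure P hP j v) = a j v :=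
  (DFunLike.congr_fun (ha j) v).symm

/-! ### Taylor coefficients of the evolution and of the memory kernel -/

namespace ProjectedDynamics

variable {𝕜 X : Type*} [RCLike 𝕜] [NormedAddCommGroup X] [NormedSpace 𝕜 X] [NormedSpace ℝ X]
  {P Q : X →L[𝕜] X} {L : X →ₗ.[𝕜] X} {T S : ℝ → X →L[𝕜] X}
  {hP : LinearMap.range (P : X →ₗ[𝕜] X) ≤ smoothDomain L.closure}
  {V : Submodule 𝕜 X} {hV : LinearMap.range (P : X →ₗ[𝕜] X) ≤ V}
  [IsScalarTower ℝ 𝕜 X] {a : ℕ → V →L[𝕜] V}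

theorem hasExpansion_evolution_sub_one (h : ProjectedDynamics P Q L T S hP)
    (hVP : ∀ v : V, P v = v) (ha : ∀ j, toEnd 𝕜 V (a j) = moment L.closure P hP V hV j) (v : V) :
    HasExpansion (fun s => (evolution T P V hV s - 1) v)
      (fun n => PowerSeries.coeff n (expGen 𝕜 a) v) := by
  have := (h.hasExpansion_evolution (hV := hV) v).sub (hasExpansion_const v)
  convert! this using 2 with s n
  rw [coeff_expGen, ← ha, natCast_inv_smul (𝕜 := 𝕜)]
  by_cases hn : n = 0
  · subst hn
    have : a 0 v = v := by
      have := DFunLike.congr_fun ((ha 0).trans (moment_zero hVP)) v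
      exact this
    simp [toEnd_apply, this]
  · simp [hn, toEnd_apply]

/-- From `QLPv = LPv - PLPv`: the orbit of the first term has moments shifted by one, and the second
is the evolution applied to `a 1 v`. -/
theorem hasExpansion_evolution_orthogonal (h : ProjectedDynamics P Q L T S hP)
    (ha : ∀ j, toEnd 𝕜 V (a j) = moment L.closure P hP V hV j) (v : V) :
    HasExpansion (fun t => toRange P V hV (T t (Q (powProj L.closure P hP 1 v))))
      (fun n => ((n ! : ℝ)⁻¹) • (a (n + 1) v - a n (a 1 v))) := by
  have h1 := (h.hasExpansion_semigroup 1 v).map (toRange P V hV)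
  have h2 := (h.hasExpansion_semigroup 0 (powProj L.closure P hP 1 v)).map (toRange P V hV)
  convert! h1.sub h2 using 2 with t n
  · rw [← map_sub, ← map_sub, powProj_zero, eq_sub_of_add_eq' (h.apply_add_apply _)]
  · rw [ContinuousLinearMap.map_smul_of_tower, ContinuousLinearMap.map_smul_of_tower, ← smul_sub,
      zero_add, add_comm 1, toRange_powProj ha, ← powProj_proj _ _ _ h.proj_proj_apply n]
    congr 2
    rw [← toRange_powProj ha n, ← toRange_powProj ha 1]
    rfl

/-- The Taylor coefficients of the memory kernel are the bipartition polynomials. -/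
theorem hasExpansion_kernelOn [CompleteSpace X] [CompleteSpace V]
    (h : ProjectedDynamics P Q L T S hP) (hVP : ∀ v : V, P v = v)
    (ha : ∀ j, toEnd 𝕜 V (a j) = moment L.closure P hP V hV j) (v : V) :
    HasExpansion (fun s => kernelOn L P Q S hP V hV s v)
      (fun n => (((n ! : 𝕜)⁻¹) • evalAt a (bipartitionPoly 𝕜 (n + 2))) v) := by
  have ha0 : a 0 = 1 := by
    ext v
    have := DFunLike.congr_fun ((ha 0).trans (moment_zero hVP)) v
    exact congrArg Subtype.val this
  obtain ⟨c, hc⟩ := h.exists_hasExpansion_kernelOn (hV := hV) (v : X)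
  obtain ⟨C, hC⟩ := h.exists_norm_evolution_le (hV := hV)
  have hker : ∀ t s, evolution T P V hV (t - s) (kernelOn L P Q S hP V hV s v) =
      toRange P V hV (T (t - s) (memoryKernel L.closure P Q hP S s v)) := fun t s => by
    rw [evolution, compress_apply, h.coe_kernelOn]
    exact congrArg (fun y => toRange P V hV (T (t - s) y)) (h.proj_memoryKernel s v)
  set d : ℕ → V := fun n => ((n ! : ℝ)⁻¹) • (a (n + 1) v - a n (a 1 v)) with hd
  -- `d'` are the coefficients given by the convolution, `d` those of the other side of Dyson's
  -- identity; uniqueness of expansions equates them.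
  let d' : ℕ → V := fun n => Nat.casesOn n 0 fun m => ∑ k ∈ Finset.range (m + 1),
    (((m - k)! : ℝ) * (k ! : ℝ) / ((m + 1)! : ℝ)) • (((m - k)! : ℝ)⁻¹ • a (m - k) (c k))
  have h1 : HasExpansion (fun t => ∫ s in (0 : ℝ)..t,
      evolution T P V hV (t - s) (kernelOn L P Q S hP V hV s v)) d' := by
    refine HasExpansion.convolution (g := fun n v => ((n ! : ℝ)⁻¹) • a n v) hC (fun w => ?_) hc
      (fun t ht => ?_) rfl fun m => rfl
    · have := h.hasExpansion_evolution (hV := hV) w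
      simp only [← ha] at this
      exact this
    · simp only [hker]
      exact h.intervalIntegrable_map_convolution (toRange P V hV) ht
        (h.continuousOn_memoryKernel v)
  have h2 : HasExpansion (fun t => ∫ s in (0 : ℝ)..t,
      evolution T P V hV (t - s) (kernelOn L P Q S hP V hV s v)) d := by
    refine (h.hasExpansion_evolution_orthogonal ha v).congr ?_
    filter_upwards [self_mem_nhdsWithin] with t ht
    simp only [hker]
    exact h.map_proj_apply_eq_integral (toRange P V hV) (fun x hx => Subtype.ext hx) v ht
  have hdd : d' = d := h1.unique h2
  -- After clearing factorials, both sequences have convolution with `a` equal to `a (m + 2) - a (m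
  -- + 1) * a 1`, applied to `v`. For the polynomials this is their recursion with the term `P̃_1 =
  -- a 1` split off.
  have key : ∀ m, ((m ! : ℝ)) • c m = evalAt a (bipartitionPoly 𝕜 (m + 2)) v := by
    refine eq_of_sum_mul_eq (y := fun m => ((m ! : ℝ)) • c m)
      (z := fun m => evalAt a (bipartitionPoly 𝕜 (m + 2)) v) ha0 fun m => ?_
    have e1 := congrFun hdd (m + 1)
    have e2 := DFunLike.congr_fun (sum_mul_evalAt_bipartitionPoly (𝕜 := 𝕜) a ha0 (m + 1)) v
    have e0 := sum_mul_evalAt_bipartitionPoly (𝕜 := 𝕜) a ha0 0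
    simp only [zero_add, Finset.range_one, Finset.sum_singleton, Nat.sub_self, ha0, one_mul] at e0
    rw [Finset.sum_range_succ', e0, Nat.sub_zero] at e2
    simp only [Nat.add_sub_add_right, add_apply, _root_.sum_apply] at e2
    have e3 : ∑ k ∈ Finset.range (m + 1), a (m - k) (evalAt a (bipartitionPoly 𝕜 (k + 2)) v) =
        a (m + 1 + 1) v - a (m + 1) (a 1 v) := eq_sub_of_add_eq e2
    rw [e3]
    have e4 : ((m + 1)! : ℝ) • d (m + 1) = a (m + 1 + 1) v - a (m + 1) (a 1 v) := by
      rw [hd]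
      exact smul_inv_smul₀ (by positivity) _
    rw [← e4, ← e1, Finset.smul_sum]
    refine Finset.sum_congr rfl fun k _ => ?_
    rw [ContinuousLinearMap.map_smul_of_tower, smul_smul, smul_smul]
    congr 1
    have i1 : ((m + 1)! : ℝ) ≠ 0 := by positivity
    have i2 : ((m - k)! : ℝ) ≠ 0 := by positivity
    field_simp
  convert! hc using 2 with n
  rw [smul_apply, ← key, ← natCast_inv_smul]
  exact inv_smul_smul₀ (by positivity) _

end ProjectedDynamics

open Asymptotics

theorem inv_factorial_smul_sub_one_pow {𝕜 A : Type*} [RCLike 𝕜] [Ring A] [Algebra 𝕜 A] (y : A)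
    (n : ℕ) : ((n ! : 𝕜)⁻¹) • (y - 1) ^ n = ∑ k ∈ Finset.range (n + 1),
      ((-1 : 𝕜) ^ (n - k) / (((n - k)! : 𝕜) * (k ! : 𝕜))) • y ^ k := by
  rw [sub_eq_add_neg, (Commute.neg_right (Commute.one_right y)).add_pow, Finset.smul_sum]
  refine Finset.sum_congr rfl fun k hk => ?_
  have hk' : k ≤ n := Nat.lt_succ_iff.1 (Finset.mem_range.1 hk)
  have e : y ^ k * (-1) ^ (n - k) * (n.choose k : A) =
      ((-1 : 𝕜) ^ (n - k) * (n.choose k : 𝕜)) • y ^ k := by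
    rw [Algebra.smul_def, map_mul, map_pow, map_neg, map_one, map_natCast, ← Nat.cast_comm,
      ← Nat.cast_comm, mul_assoc]
    rw [((Commute.neg_one_right y).pow_pow k (n - k)).eq]
  rw [e, smul_smul, Nat.cast_choose 𝕜 hk']
  congr 1
  have h1 : (n ! : 𝕜) ≠ 0 := Nat.cast_ne_zero.2 n.factorial_ne_zero
  field_simp

theorem termIntegrand_eq {𝕜 X : Type*} [RCLike 𝕜] [NormedAddCommGroup X] [NormedSpace 𝕜 X]
    {P : X →L[𝕜] X} {T : ℝ → X →L[𝕜] X} {V : Submodule 𝕜 X}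
    {hV : LinearMap.range (P : X →ₗ[𝕜] X) ≤ V} (F : ℕ → V →L[𝕜] V) (n k : ℕ) (t : ℝ) (x : X) (s : ℝ) :
    termIntegrand T P V hV (fun n => toEnd 𝕜 V (F n)) n k t x s =
      P (T (t - s) (F n ((evolution T P V hV s ^ k) (toRange P V hV x)) : V)) := by
  rw [termIntegrand, ← toEnd_evolution, ← map_pow]
  rfl

/-! ### The expansions to all orders in time -/

namespace ProjectedDynamics

variable {𝕜 X : Type*} [RCLike 𝕜] [NormedAddCommGroup X] [NormedSpace 𝕜 X] [NormedSpace ℝ X]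
  {P Q : X →L[𝕜] X} {L : X →ₗ.[𝕜] X} {T S : ℝ → X →L[𝕜] X}
  {hP : LinearMap.range (P : X →ₗ[𝕜] X) ≤ smoothDomain L.closure}
  {V : Submodule 𝕜 X} {hV : LinearMap.range (P : X →ₗ[𝕜] X) ≤ V}

theorem continuousOn_evolution_sub_one_pow_apply [CompleteSpace X]
    (h : ProjectedDynamics P Q L T S hP) (k : ℕ) (v : V) :
    ContinuousOn (fun s => ((evolution T P V hV s - 1) ^ k) v) (Ici 0) := by
  induction k with
  | zero => exact continuousOn_const
  | succ k ih =>
    simp only [pow_succ']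
    exact (h.continuousOn_evolution_apply (hV := hV) ih).sub ih

theorem continuousOn_apply_evolution_sub_one_pow_apply [CompleteSpace X]
    (h : ProjectedDynamics P Q L T S hP) (f : V →L[𝕜] V) (k : ℕ) (v : V) :
    ContinuousOn (fun s => (f (((evolution T P V hV s - 1) ^ k) v) : X)) (Ici 0) :=
  continuous_subtype_val.comp_continuousOn
    (f.continuous.comp_continuousOn (h.continuousOn_evolution_sub_one_pow_apply k v))

theorem intervalIntegrable_termIntegrand [CompleteSpace X] (h : ProjectedDynamics P Q L T S hP)
    (F : ℕ → V →L[𝕜] V) (n k : ℕ) {t : ℝ} (ht : 0 ≤ t) (x : X) :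
    IntervalIntegrable (termIntegrand T P V hV (fun n => toEnd 𝕜 V (F n)) n k t x)
      MeasureTheory.volume 0 t := by
  have := h.intervalIntegrable_map_convolution P ht (continuous_subtype_val.comp_continuousOn
    ((F n).continuous.comp_continuousOn
      (h.continuousOn_evolution_pow_apply (hV := hV) k (toRange P V hV x))))
  refine this.congr ?_
  exact fun s _ => (termIntegrand_eq F n k t x s).symm

theorem isBigO_integral_convolution [CompleteSpace X] (h : ProjectedDynamics P Q L T S hP)
    {u : ℝ → X} {N : ℕ} (hu : u =O[𝓝[≥] 0] fun s => s ^ N) :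
    (fun t => ∫ s in (0 : ℝ)..t, P (T (t - s) (u s))) =O[𝓝[≥] 0] fun t => t ^ (N + 1) := by
  obtain ⟨C, hC, hb⟩ := hu.exists_pos
  obtain ⟨δ, hδ, hsub⟩ := mem_nhdsGE_iff_exists_Ico_subset.1 hb.bound
  obtain ⟨D, hD⟩ := h.isSemigroup.exists_norm_le δ
  refine IsBigO.of_bound (‖P‖ * (|D| * C)) ?_
  filter_upwards [Ico_mem_nhdsGE hδ] with t ht
  have ht0 : 0 ≤ t := ht.1
  have : ∀ s ∈ uIoc 0 t, ‖P (T (t - s) (u s))‖ ≤ ‖P‖ * (|D| * (C * t ^ N)) := by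
    intro s hs
    rw [uIoc_of_le ht0] at hs
    refine P.le_opNorm_of_le ((T _).le_of_opNorm_le_of_le ?_ ?_)
    · exact (hD _ ⟨by linarith [hs.2], by linarith [hs.1, ht.2]⟩).trans (le_abs_self D)
    · have h1 : _ ≤ C * ‖s ^ N‖ := hsub ⟨hs.1.le, hs.2.trans_lt ht.2⟩
      rw [norm_pow, Real.norm_of_nonneg hs.1.le] at h1
      refine h1.trans ?_
      gcongr
      · exact hs.1.le
      · exact hs.2
  refine (intervalIntegral.norm_integral_le_of_norm_le_const this).trans (le_of_eq ?_)
  rw [sub_zero, norm_pow, Real.norm_of_nonneg ht0, abs_of_nonneg ht0, pow_succ]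
  ring

theorem memoryKernel_proj (h : ProjectedDynamics P Q L T S hP) (s : ℝ) (x : X) :
    memoryKernel L.closure P Q hP S s (P x) = memoryKernel L.closure P Q hP S s x := by
  rw [memoryKernel, memoryKernel, powProj_proj _ _ _ h.proj_proj_apply]

theorem coe_kernelOn_toRange (h : ProjectedDynamics P Q L T S hP) (s : ℝ) (x : X) :
    (kernelOn L P Q S hP V hV s (toRange P V hV x) : X) =
      memoryKernel L.closure P Q hP S s x := by
  rw [h.coe_kernelOn, coe_toRange_apply, h.memoryKernel_proj]

variable [IsScalarTower ℝ 𝕜 X]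

/-- By the binomial theorem the sum over `k` collapses, under the integral, to one power of `E(s) -
1`, which is small as `s → 0+`. -/
theorem memoryTerm_eq_integral [CompleteSpace X] (h : ProjectedDynamics P Q L T S hP)
    (F : ℕ → V →L[𝕜] V) (n : ℕ) {t : ℝ} (ht : 0 ≤ t) (x : X) :
    memoryTerm T P V hV (fun n => toEnd 𝕜 V (F n)) n t x =
      ∫ s in (0 : ℝ)..t, P (T (t - s)
        ((((n ! : 𝕜)⁻¹) • F n) (((evolution T P V hV s - 1) ^ n) (toRange P V hV x)) : V)) := by
  rw [memoryTerm]
  have hi := h.intervalIntegrable_termIntegrand (hV := hV) F n (ht := ht) (x := x)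
  simp only [← intervalIntegral.integral_smul]
  rw [← intervalIntegral.integral_finsetSum fun k _ => (show IntervalIntegrable (fun s =>
    ((-1 : 𝕜) ^ (n - k) / (((n - k)! : 𝕜) * (k ! : 𝕜))) •
      termIntegrand T P V hV (fun n => toEnd 𝕜 V (F n)) n k t x s) _ _ _ from (hi k).smul _)]
  congr 1
  funext s
  simp only [termIntegrand_eq]
  rw [smul_apply, ← map_smul, ← smul_apply, inv_factorial_smul_sub_one_pow]
  simp only [_root_.sum_apply, map_sum, AddSubmonoidClass.coe_finsetSum, smul_apply, map_smul,
    SetLike.val_smul]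

variable {a : ℕ → V →L[𝕜] V} {R : V →L[𝕜] V}

/-- Both sides have expansions, and their coefficients of order `m ≤ N` agree by the word equation:
terms with index above `m` start beyond order `m`. -/
theorem isBigO_kernelOn_sub_sum [CompleteSpace X] [CompleteSpace V]
    (h : ProjectedDynamics P Q L T S hP) (hVP : ∀ v : V, P v = v)
    (ha : ∀ j, toEnd 𝕜 V (a j) = moment L.closure P hP V hV j) (hR : a 1 * R = 1)
    (hR' : R * a 1 = 1) (N : ℕ) (v : V) :
    (fun s => kernelOn L P Q S hP V hV s v - ∑ n ∈ Finset.range (N + 1),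
      (((n ! : 𝕜)⁻¹) • wordSolution 𝕜 a R n) (((evolution T P V hV s - 1) ^ n) v))
      =O[𝓝[≥] 0] fun s => s ^ (N + 1) := by
  obtain ⟨C, hC⟩ := h.exists_norm_evolution_le (hV := hV)
  have hC' : ∀ᶠ s in 𝓝[≥] 0, ‖evolution T P V hV s - 1‖ ≤ C + ‖(1 : V →L[𝕜] V)‖ := by
    filter_upwards [hC] with s hs
    exact (norm_sub_le _ _).trans (by gcongr)
  have h1 := fun n => hasExpansion_pow_apply hC' (h.hasExpansion_evolution_sub_one hVP ha) n v
  have h2 := HasExpansion.sum (Finset.range (N + 1)) fun n _ =>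
    (h1 n).map (((n ! : 𝕜)⁻¹) • wordSolution 𝕜 a R n)
  refine ((h.hasExpansion_kernelOn hVP ha v).sub h2).isBigO_of_eq_zero fun m hm => ?_
  rw [smul_bipartitionPoly_eq_sum a R hR hR', sub_eq_zero, _root_.sum_apply]
  refine Finset.sum_subset (Finset.range_mono (by omega)) fun k _ hk => ?_
  rw [Finset.mem_range, not_lt] at hk
  rw [coeff_expGen_pow, if_neg (by omega), mul_zero]
  rfl

theorem isBigO_memoryKernel_sub_sum [CompleteSpace X] [CompleteSpace V]
    (h : ProjectedDynamics P Q L T S hP) (hVP : ∀ v : V, P v = v)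
    (ha : ∀ j, toEnd 𝕜 V (a j) = moment L.closure P hP V hV j) (hR : a 1 * R = 1)
    (hR' : R * a 1 = 1) (N : ℕ) (x : X) :
    (fun s => memoryKernel L.closure P Q hP S s x - ∑ n ∈ Finset.range (N + 1),
      ((((n ! : 𝕜)⁻¹) • wordSolution 𝕜 a R n)
        (((evolution T P V hV s - 1) ^ n) (toRange P V hV x)) : X))
      =O[𝓝[≥] 0] fun s => s ^ (N + 1) := by
  have := (V.subtypeL.isBigO_comp _ _).trans
    (h.isBigO_kernelOn_sub_sum hVP ha hR hR' N (toRange P V hV x))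
  refine this.congr_left fun s => ?_
  rw [map_sub, map_sum]
  exact congrArg₂ _ (h.coe_kernelOn_toRange s x) rfl

/-- By the exact identity, the difference is the convolution of the kernel's remainder, and the
integration gains one order. -/
theorem isBigO_deriv_sub_sum [CompleteSpace X] [CompleteSpace V]
    (h : ProjectedDynamics P Q L T S hP) (hVP : ∀ v : V, P v = v)
    (ha : ∀ j, toEnd 𝕜 V (a j) = moment L.closure P hP V hV j) (hR : a 1 * R = 1)
    (hR' : R * a 1 = 1) (N : ℕ) (x : X) :
    (fun t : ℝ => derivWithin (fun τ => P (T τ (P x))) (Ici 0) t -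
      (P (T t (P (powProj L.closure P hP 1 x))) + ∑ n ∈ Finset.range (N + 1),
        memoryTerm T P V hV (fun n => toEnd 𝕜 V (wordSolution 𝕜 a R n)) n t x))
      =O[𝓝[≥] 0] fun t => t ^ (N + 2) := by
  refine (h.isBigO_integral_convolution
    (h.isBigO_memoryKernel_sub_sum hVP ha hR hR' N x)).congr' ?_ EventuallyEq.rfl
  filter_upwards [self_mem_nhdsWithin] with t ht
  have ht0 : (0 : ℝ) ≤ t := ht
  rw [(h.hasDerivWithinAt_proj x ht).derivWithin (uniqueDiffOn_Ici 0 t ht),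
    add_sub_add_left_eq_sub]
  simp only [fun n => h.memoryTerm_eq_integral (hV := hV) (wordSolution 𝕜 a R) n ht0 x]
  have hi : ∀ n, IntervalIntegrable (fun s => P (T (t - s) (((((n ! : 𝕜)⁻¹) •
      wordSolution 𝕜 a R n) (((evolution T P V hV s - 1) ^ n) (toRange P V hV x)) : V) : X)))
      MeasureTheory.volume 0 t := fun n => h.intervalIntegrable_map_convolution P ht0
        (h.continuousOn_apply_evolution_sub_one_pow_apply _ n _)
  rw [← intervalIntegral.integral_finsetSum fun n _ => hi n,
    ← intervalIntegral.integral_sub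
      (h.intervalIntegrable_map_convolution P ht0 (h.continuousOn_memoryKernel x))
      (by simpa only [Finset.sum_fn] using
        IntervalIntegrable.sum (Finset.range (N + 1)) fun n _ => hi n)]
  simp only [map_sub, map_sum]

end ProjectedDynamics

/-! ### Analytic functions of operators and the identity theorem -/

section Analytic

open Asymptotics

/-- An operator-valued power series `∑ f_n y^n` that converges normally for `‖y‖ = ρ` is analytic
for `‖y‖ < ρ`. -/
theorem exists_analyticAt_hasSum_mul_pow {𝕜 A : Type*} [RCLike 𝕜] [NormedRing A]
    [NormedAlgebra 𝕜 A] [CompleteSpace A] {f : ℕ → A} {ρ : ℝ} (hρ : 0 < ρ)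
    (hf : Summable fun n => ‖f n‖ * ρ ^ n) :
    ∃ H : A → A, (∀ y, ‖y‖ < ρ → HasSum (fun n => f n * y ^ n) (H y)) ∧
      (∀ y, ‖y‖ < ρ → AnalyticAt 𝕜 H y) ∧
      ∀ N, (fun y => H y - ∑ n ∈ Finset.range N, f n * y ^ n) =O[𝓝 0] fun y => ‖y‖ ^ N := by
  lift ρ to NNReal using hρ.le
  let p : FormalMultilinearSeries 𝕜 A A := fun n =>
    (ContinuousLinearMap.mul 𝕜 A (f n)).compContinuousMultilinearMap
      (ContinuousMultilinearMap.mkPiAlgebraFin 𝕜 n A)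
  have hpy : ∀ n (y : A), p n (fun _ => y) = f n * y ^ n := fun n y => by simp [p]
  have hpn : ∀ n, ‖p n‖ ≤ max 1 ‖(1 : A)‖ * ‖f n‖ := fun n => by
    refine (ContinuousLinearMap.norm_compContinuousMultilinearMap_le _ _).trans ?_
    rw [mul_comm]
    gcongr
    · exact ContinuousMultilinearMap.norm_mkPiAlgebraFin_le
    · exact ContinuousLinearMap.opNorm_mul_apply_le 𝕜 A (f n)
  have hrad : (ρ : ENNReal) ≤ p.radius := by
    refine p.le_radius_of_summable ?_
    refine Summable.of_nonneg_of_le (fun n => by positivity) (fun n => ?_)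
      (hf.mul_left (max 1 ‖(1 : A)‖))
    rw [← mul_assoc]
    exact mul_le_mul_of_nonneg_right (hpn n) (by positivity)
  have hpos : 0 < p.radius := lt_of_lt_of_le (by exact_mod_cast hρ) hrad
  have hp := p.hasFPowerSeriesOnBall hpos
  have hmem : ∀ y : A, ‖y‖ < ρ → y ∈ Metric.eball (0 : A) p.radius := fun y hy => by
    rw [mem_eball_zero_iff]
    refine lt_of_lt_of_le ?_ hrad
    rw [enorm_eq_nnnorm]
    exact_mod_cast hy
  refine ⟨p.sum, fun y hy => ?_, fun y hy => hp.analyticAt_of_mem (hmem y hy), fun N => ?_⟩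
  · have := hp.hasSum (hmem y hy)
    simpa only [hpy, zero_add] using this
  · have := hp.hasFPowerSeriesAt.isBigO_sub_partialSum_pow N
    simpa only [FormalMultilinearSeries.partialSum, hpy, zero_add] using this

variable {E : Type*} [NormedAddCommGroup E] [NormedSpace ℝ E] [CompleteSpace E]

/-- Identity theorem on a half-open interval: an analytic function is determined by its one-sided
asymptotic expansion at the end point. -/
theorem HasExpansion.eqOn_zero_of_analyticOn {g : ℝ → E} {τ : ℝ}
    (hg : AnalyticOn ℝ g (Ico 0 τ)) (h : HasExpansion g 0) : EqOn g 0 (Ico 0 τ) := by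
  intro s hs
  have hτ : 0 < τ := hs.1.trans_lt hs.2
  obtain ⟨p, g', hp, hgp, hE⟩ := exists_hasFPowerSeriesAt_hasExpansion hτ (hg 0 ⟨le_rfl, hτ⟩)
  have hp0 : p = 0 := by
    funext n
    exact FormalMultilinearSeries.coeff_eq_zero.1 (congrFun (hE.unique h) n)
  rw [hp0] at hp
  have hz : ∀ᶠ s in 𝓝[≥] 0, g s = 0 := by
    filter_upwards [hgp, hp.eventually_eq_zero.filter_mono nhdsWithin_le_nhds] with s h1 h2
    rw [← h1, h2]
  rcases hs.1.eq_or_lt with rfl | hs0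
  · exact hz.self_of_nhdsWithin self_mem_Ici
  · obtain ⟨δ, hδ, hsub⟩ := mem_nhdsGE_iff_exists_Ico_subset.1 hz
    have hδ' : (0 : ℝ) < δ := hδ
    have hmin : 0 < min δ τ := lt_min hδ' hτ
    -- An interior point of the domain near which `g` already vanishes; the usual identity theorem
    -- starts there.
    have hmem : min δ τ / 2 ∈ Ioo 0 τ :=
      ⟨by linarith, by linarith [min_le_right δ τ]⟩
    have han : AnalyticOnNhd ℝ g (Ioo 0 τ) :=
      isOpen_Ioo.analyticOn_iff_analyticOnNhd.1 (hg.mono Ioo_subset_Ico_self)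
    refine han.eqOn_zero_of_preconnected_of_eventuallyEq_zero isPreconnected_Ioo hmem ?_
      ⟨hs0, hs.2⟩
    filter_upwards [Ioo_mem_nhds (show 0 < min δ τ / 2 by linarith)
      (show min δ τ / 2 < δ by linarith [min_le_left δ τ])] with r hr
    exact hsub ⟨hr.1.le, hr.2⟩

end Analytic

open Asymptotics

/-- The map `M ↦ (P M)|_V`, as a continuous linear map. -/
noncomputable def compressCLM {𝕜 X : Type*} [RCLike 𝕜] [NormedAddCommGroup X] [NormedSpace 𝕜 X]
    (P : X →L[𝕜] X) (V : Submodule 𝕜 X) (hV : LinearMap.range (P : X →ₗ[𝕜] X) ≤ V) :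
    (X →L[𝕜] X) →L[𝕜] (V →L[𝕜] V) :=
  LinearMap.mkContinuous
    { toFun := compress P V hV
      map_add' := fun M N => by
        ext v
        simp [compress_apply]
      map_smul' := fun c M => by
        ext v
        simp [compress_apply] }
    ‖P‖ (norm_compress_le P V hV)

theorem compress_eq_kernelOn {𝕜 X : Type*} [RCLike 𝕜] [NormedAddCommGroup X] [NormedSpace 𝕜 X]
    {P Q : X →L[𝕜] X} {L : X →ₗ.[𝕜] X} {S : ℝ → X →L[𝕜] X}
    {hP : LinearMap.range (P : X →ₗ[𝕜] X) ≤ smoothDomain L.closure}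
    {V : Submodule 𝕜 X} {hV : LinearMap.range (P : X →ₗ[𝕜] X) ≤ V} {I : Set ℝ} {K : ℝ → X →L[𝕜] X}
    (hKI : ∀ s ∈ I, ∀ x : X, K s x = memoryKernel L.closure P Q hP S s x) {s : ℝ} (hs : s ∈ I)
    (v : V) : compress P V hV (K s) v = kernelOn L P Q S hP V hV s v := by
  rw [compress_apply, hKI s hs, kernelOn]

theorem analyticOn_clm_apply {𝕜 E F : Type*} [RCLike 𝕜] [NormedAddCommGroup E] [NormedSpace 𝕜 E]
    [NormedAddCommGroup F] [NormedSpace 𝕜 F] [NormedSpace ℝ F] [IsScalarTower ℝ 𝕜 F]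
    {I : Set ℝ} {G : ℝ → E →L[𝕜] F} (hG : AnalyticOn ℝ G I) (v : E) :
    AnalyticOn ℝ (fun s => G s v) I :=
  ((ContinuousLinearMap.apply 𝕜 F v).restrictScalars ℝ).comp_analyticOn hG

theorem hasExpansion_clm_apply {𝕜 E F : Type*} [RCLike 𝕜] [NormedAddCommGroup E] [NormedSpace 𝕜 E]
    [NormedAddCommGroup F] [NormedSpace 𝕜 F] [NormedSpace ℝ F] [IsScalarTower ℝ 𝕜 F]
    {G : ℝ → E →L[𝕜] F} {c : ℕ → E →L[𝕜] F} (hG : HasExpansion G c) (v : E) :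
    HasExpansion (fun s => G s v) (fun n => c n v) :=
  hG.map (ContinuousLinearMap.apply 𝕜 F v)

/-! ### Convergence in the analytic case -/

namespace ProjectedDynamics

variable {𝕜 X : Type*} [RCLike 𝕜] [NormedAddCommGroup X] [NormedSpace 𝕜 X] [NormedSpace ℝ X]
  [IsScalarTower ℝ 𝕜 X] {P Q : X →L[𝕜] X} {L : X →ₗ.[𝕜] X} {T S : ℝ → X →L[𝕜] X}
  {hP : LinearMap.range (P : X →ₗ[𝕜] X) ≤ smoothDomain L.closure}
  {V : Submodule 𝕜 X} {hV : LinearMap.range (P : X →ₗ[𝕜] X) ≤ V}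

theorem analyticOn_evolution (h : ProjectedDynamics P Q L T S hP) {I : Set ℝ}
    (hT : AnalyticOn ℝ (fun s => P * T s * P) I) : AnalyticOn ℝ (evolution T P V hV) I := by
  refine (((compressCLM P V hV).restrictScalars ℝ).comp_analyticOn hT).congr fun s _ => ?_
  ext v
  exact (h.proj_proj_apply _).symm

theorem analyticOn_compress {I : Set ℝ} {K : ℝ → X →L[𝕜] X} (hK : AnalyticOn ℝ K I) :
    AnalyticOn ℝ (fun s => compress P V hV (K s)) I :=
  ((compressCLM P V hV).restrictScalars ℝ).comp_analyticOn hK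

variable {a : ℕ → V →L[𝕜] V} {R : V →L[𝕜] V}

/-- Analyticity in norm gives some norm expansion with geometrically bounded coefficients;
comparison with the strong expansion, vector by vector, identifies them. -/
theorem hasExpansion_evolution_sub_one_of_analyticOn [CompleteSpace V]
    (h : ProjectedDynamics P Q L T S hP) (hVP : ∀ v : V, P v = v)
    (ha : ∀ j, toEnd 𝕜 V (a j) = moment L.closure P hP V hV j) {δ : ℝ} (hδ : 0 < δ)
    (hT : AnalyticOn ℝ (evolution T P V hV) (Ico 0 δ)) :
    HasExpansion (fun s => evolution T P V hV s - 1)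
      (fun n => PowerSeries.coeff n (expGen 𝕜 a)) ∧
    GeomBounded fun n => PowerSeries.coeff n (expGen 𝕜 a) := by
  obtain ⟨c, hc, hcb⟩ := hasExpansion_of_analyticWithinAt hδ
    ((hT.sub analyticOn_const : AnalyticOn ℝ (fun s => evolution T P V hV s - 1) (Ico 0 δ)) 0
      ⟨le_rfl, hδ⟩)
  have : c = fun n => PowerSeries.coeff n (expGen 𝕜 a) := by
    funext n
    ext1 v
    exact congrFun ((hasExpansion_clm_apply hc v).unique
      (h.hasExpansion_evolution_sub_one hVP ha v)) n
  rw [← this]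
  exact ⟨hc, hcb⟩

theorem isBigO_evolution_sub_one [CompleteSpace V]
    (h : ProjectedDynamics P Q L T S hP) (hVP : ∀ v : V, P v = v)
    (ha : ∀ j, toEnd 𝕜 V (a j) = moment L.closure P hP V hV j) {δ : ℝ} (hδ : 0 < δ)
    (hT : AnalyticOn ℝ (evolution T P V hV) (Ico 0 δ)) :
    (fun s => evolution T P V hV s - 1) =O[𝓝[≥] 0] fun s : ℝ => s ^ 1 := by
  refine (h.hasExpansion_evolution_sub_one_of_analyticOn hVP ha hδ hT).1.isBigO_of_eq_zero
    fun n hn => ?_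
  rw [coeff_expGen, if_pos (by omega)]

theorem tendsto_evolution_sub_one [CompleteSpace V]
    (h : ProjectedDynamics P Q L T S hP) (hVP : ∀ v : V, P v = v)
    (ha : ∀ j, toEnd 𝕜 V (a j) = moment L.closure P hP V hV j) {δ : ℝ} (hδ : 0 < δ)
    (hT : AnalyticOn ℝ (evolution T P V hV) (Ico 0 δ)) :
    Tendsto (fun s => evolution T P V hV s - 1) (𝓝[≥] 0) (𝓝 0) := by
  refine (h.isBigO_evolution_sub_one hVP ha hδ hT).trans_tendsto ?_
  simp only [pow_one]
  exact tendsto_id.mono_left nhdsWithin_le_nhds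

/-- The expansion of the memory kernel is an identity where it converges normally. -/
theorem hasSum_kernelOn [CompleteSpace X] [CompleteSpace V]
    (h : ProjectedDynamics P Q L T S hP) (hVP : ∀ v : V, P v = v)
    (ha : ∀ j, toEnd 𝕜 V (a j) = moment L.closure P hP V hV j) (hR : a 1 * R = 1)
    (hR' : R * a 1 = 1) {τ r ρ : ℝ} (hr : 0 ≤ r) (hrρ : r < ρ)
    (hsum : Summable fun n => ‖((n ! : 𝕜)⁻¹) • wordSolution 𝕜 a R n‖ * ρ ^ n)
    (hT : AnalyticOn ℝ (evolution T P V hV) (Ico 0 τ)) {v : V}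
    (hK : AnalyticOn ℝ (fun s => kernelOn L P Q S hP V hV s v) (Ico 0 τ))
    (hbound : ∀ s ∈ Ico 0 τ, ‖evolution T P V hV s - 1‖ ≤ r) {s : ℝ} (hs : s ∈ Ico 0 τ) :
    HasSum (fun n => (((n ! : 𝕜)⁻¹) • wordSolution 𝕜 a R n)
      (((evolution T P V hV s - 1) ^ n) v)) (kernelOn L P Q S hP V hV s v) := by
  have hτ : 0 < τ := hs.1.trans_lt hs.2
  obtain ⟨H, hH, hHa, hHO⟩ := exists_analyticAt_hasSum_mul_pow (𝕜 := 𝕜) (hr.trans_lt hrρ) hsum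
  have hY : AnalyticOn ℝ (fun s => evolution T P V hV s - 1) (Ico 0 τ) := hT.sub analyticOn_const
  have hHY : AnalyticOn ℝ (fun s => H (evolution T P V hV s - 1)) (Ico 0 τ) := fun s hs =>
    AnalyticAt.comp_analyticWithinAt (g := H) (f := fun s => evolution T P V hV s - 1)
      (hHa _ ((hbound s hs).trans_lt hrρ)).restrictScalars (hY s hs)
  have hg : AnalyticOn ℝ (fun s => kernelOn L P Q S hP V hV s v -
      H (evolution T P V hV s - 1) v) (Ico 0 τ) := hK.sub (analyticOn_clm_apply hHY v)
  -- Truncated at any order, both terms share the same partial sum in powers of `E(s) - 1`, and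
  -- `E(s) - 1` is `O(s)`.
  have hE : HasExpansion (fun s => kernelOn L P Q S hP V hV s v -
      H (evolution T P V hV s - 1) v) 0 := by
    refine HasExpansion.of_succ fun N => ?_
    have h1 := h.isBigO_kernelOn_sub_sum (hV := hV) hVP ha hR hR' N v
    have h2 := (hHO (N + 1)).comp_tendsto (h.tendsto_evolution_sub_one hVP ha hτ hT)
    have h3 : (fun s => ‖evolution T P V hV s - 1‖ ^ (N + 1)) =O[𝓝[≥] 0]
        fun s : ℝ => s ^ (N + 1) := by
      have := (h.isBigO_evolution_sub_one hVP ha hτ hT).norm_left.pow (N + 1)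
      simpa only [pow_one] using this
    have h4 := ((ContinuousLinearMap.apply 𝕜 V v).isBigO_comp _ _).trans (h2.trans h3)
    refine (h1.sub h4).congr_left fun s => ?_
    simp only [Pi.zero_apply, smul_zero, Finset.sum_const_zero, sub_zero, Function.comp_apply,
      ContinuousLinearMap.apply_apply, sub_apply, _root_.sum_apply,
      mul_apply_eq_comp]
    abel
  have hz := hE.eqOn_zero_of_analyticOn hg hs
  rw [sub_eq_zero.1 hz]
  exact (hH _ ((hbound s hs).trans_lt hrρ)).map (ContinuousLinearMap.apply 𝕜 V v)
    (ContinuousLinearMap.apply 𝕜 V v).continuous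

/-- Integrates the kernel series term by term by dominated convergence; the dominating functions are
constant in `s` and summable since `r < ρ`. -/
theorem hasSum_memoryTerm [CompleteSpace X] [CompleteSpace V]
    (h : ProjectedDynamics P Q L T S hP) (hVP : ∀ v : V, P v = v)
    (ha : ∀ j, toEnd 𝕜 V (a j) = moment L.closure P hP V hV j) (hR : a 1 * R = 1)
    (hR' : R * a 1 = 1) {τ r ρ : ℝ} (hr : 0 ≤ r) (hrρ : r < ρ)
    (hsum : Summable fun n => ‖((n ! : 𝕜)⁻¹) • wordSolution 𝕜 a R n‖ * ρ ^ n)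
    {K : ℝ → X →L[𝕜] X}
    (hKI : ∀ s ∈ Ico 0 τ, ∀ x : X, K s x = memoryKernel L.closure P Q hP S s x)
    (hK : AnalyticOn ℝ K (Ico 0 τ)) (hT : AnalyticOn ℝ (fun s => P * T s * P) (Ico 0 τ))
    (hbound : ∀ s ∈ Ico 0 τ, ‖evolution T P V hV s - 1‖ ≤ r) {t : ℝ} (ht : t ∈ Ico 0 τ) (x : X) :
    HasSum (fun n => memoryTerm T P V hV (fun n => toEnd 𝕜 V (wordSolution 𝕜 a R n)) n t x)
      (∫ s in (0 : ℝ)..t, P (T (t - s) (memoryKernel L.closure P Q hP S s x))) := by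
  have hK' : AnalyticOn ℝ (fun s => kernelOn L P Q S hP V hV s (toRange P V hV x)) (Ico 0 τ) :=
    (analyticOn_clm_apply (analyticOn_compress hK) (toRange P V hV x)).congr fun s hs =>
      (compress_eq_kernelOn (hV := hV) hKI hs (toRange P V hV x)).symm
  have hTV := h.analyticOn_evolution (hV := hV) hT
  obtain ⟨D, hD⟩ := h.isSemigroup.exists_norm_le t
  simp only [fun n => h.memoryTerm_eq_integral (hV := hV) (wordSolution 𝕜 a R) n ht.1 x]
  have hsr : Summable fun n => ‖((n ! : 𝕜)⁻¹) • wordSolution 𝕜 a R n‖ * r ^ n :=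
    Summable.of_nonneg_of_le (fun n => by positivity) (fun n => by gcongr) hsum
  refine intervalIntegral.hasSum_integral_of_dominated_convergence
    (fun n _ => ‖P‖ * (|D| * (‖((n ! : 𝕜)⁻¹) • wordSolution 𝕜 a R n‖ * r ^ n *
      ‖toRange P V hV x‖))) (fun n => ?_) (fun n => ?_) ?_ ?_ ?_
  · have := h.intervalIntegrable_map_convolution P ht.1
      (h.continuousOn_apply_evolution_sub_one_pow_apply (hV := hV)
        (((n ! : 𝕜)⁻¹) • wordSolution 𝕜 a R n) n (toRange P V hV x))
    exact (intervalIntegrable_iff.1 this).aestronglyMeasurable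
  · refine Eventually.of_forall fun s hs => ?_
    rw [uIoc_of_le ht.1] at hs
    have hs' : s ∈ Ico 0 τ := ⟨hs.1.le, hs.2.trans_lt ht.2⟩
    refine P.le_opNorm_of_le ((T _).le_of_opNorm_le_of_le ?_ ?_)
    · exact (hD _ ⟨by linarith [hs.2], by linarith [hs.1]⟩).trans (le_abs_self D)
    · rw [mul_assoc]
      change ‖(((n ! : 𝕜)⁻¹) • wordSolution 𝕜 a R n) _‖ ≤ _
      refine ContinuousLinearMap.le_opNorm_of_le _ (ContinuousLinearMap.le_of_opNorm_le _ ?_ _)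
      -- For `n = 0` one needs `‖1‖ ≤ 1`, true for operators even if `V` is trivial.
      rcases n.eq_zero_or_pos with rfl | hn
      · rw [pow_zero, pow_zero]
        exact ContinuousLinearMap.norm_id_le
      · exact (norm_pow_le' _ hn).trans (by gcongr; exact hbound s hs')
  · exact Eventually.of_forall fun s _ => (((hsr.mul_right _).mul_left _).mul_left _)
  · exact intervalIntegrable_const
  · refine Eventually.of_forall fun s hs => ?_
    rw [uIoc_of_le ht.1] at hs
    have hs' : s ∈ Ico 0 τ := ⟨hs.1.le, hs.2.trans_lt ht.2⟩
    have := h.hasSum_kernelOn hVP ha hR hR' hr hrρ hsum hTV hK' hbound hs'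
    have := this.map ((P.comp (T (t - s))).comp V.subtypeL)
      ((P.comp (T (t - s))).comp V.subtypeL).continuous
    rw [← h.coe_kernelOn_toRange (hV := hV) s x]
    exact this

theorem geomBounded_wordSolution [CompleteSpace X] [CompleteSpace V]
    (h : ProjectedDynamics P Q L T S hP) (hVP : ∀ v : V, P v = v)
    (ha : ∀ j, toEnd 𝕜 V (a j) = moment L.closure P hP V hV j) (hR : a 1 * R = 1)
    (hR' : R * a 1 = 1) {δ : ℝ} (hδ : 0 < δ) {K : ℝ → X →L[𝕜] X}
    (hKI : ∀ s ∈ Ico 0 δ, ∀ x : X, K s x = memoryKernel L.closure P Q hP S s x)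
    (hK : AnalyticOn ℝ K (Ico 0 δ)) (hT : AnalyticOn ℝ (fun s => P * T s * P) (Ico 0 δ)) :
    GeomBounded fun n => ((n ! : 𝕜)⁻¹) • wordSolution 𝕜 a R n := by
  obtain ⟨C, M, hC, hM, hCM⟩ := (h.hasExpansion_evolution_sub_one_of_analyticOn hVP ha hδ
    (h.analyticOn_evolution (hV := hV) hT)).2
  have hU : GeomBounded fun n => PowerSeries.coeff n (expGenDiv 𝕜 a) := by
    -- Dividing by `X` shifts the index, which costs one factor `M`.
    refine ⟨C * M, M, one_le_mul_of_one_le_of_one_le hC hM, hM, fun n => ?_⟩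
    have : ‖PowerSeries.coeff (n + 1) (expGen 𝕜 a)‖ ≤ _ := hCM (n + 1)
    rw [expGen_eq_X_mul, PowerSeries.coeff_succ_X_mul] at this
    exact this.trans (le_of_eq (by ring))
  obtain ⟨c, hc, hcb⟩ := hasExpansion_of_analyticWithinAt hδ
    (analyticOn_compress (V := V) (hV := hV) hK 0 ⟨le_rfl, hδ⟩)
  have hcp : c = fun n => PowerSeries.coeff n (PowerSeries.mk fun n =>
      ((n ! : 𝕜)⁻¹) • evalAt a (bipartitionPoly 𝕜 (n + 2))) := by
    funext n
    ext1 v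
    rw [PowerSeries.coeff_mk]
    refine congrFun ((hasExpansion_clm_apply hc v).unique
      ((h.hasExpansion_kernelOn hVP ha v).congr ?_)) n
    filter_upwards [Ico_mem_nhdsGE hδ] with s hs
    exact (compress_eq_kernelOn hKI hs v).symm
  rw [hcp] at hcb
  have h0 : PowerSeries.coeff 0 (expGenDiv 𝕜 a) = a 1 := by simp [expGenDiv]
  refine geomBounded_of_eq_sum_mul_pow (R := R) (by rw [h0, hR]) (by rw [h0, hR'])
    (fun n => ?_) hcb hU
  rw [PowerSeries.coeff_mk, smul_bipartitionPoly_eq_sum a R hR hR', expGen_eq_X_mul]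

end ProjectedDynamics

end CMZE

/-! ### The Mori–Zwanzig theorem -/

theorem theorem2 {𝕜 X : Type*} [RCLike 𝕜] [NormedAddCommGroup X] [NormedSpace 𝕜 X]
    [NormedSpace ℝ X] [IsScalarTower ℝ 𝕜 X] [CompleteSpace X]
    -- complementary projections
    (P Q : X →L[𝕜] X) (hPQ : P + Q = 1) (hPQ0 : P * Q = 0)
    -- the closures of `L` and `Q L` generate `T t = e^{tL}` and `S t = e^{tQL}`
    (L : X →ₗ.[𝕜] X) (T S : ℝ → X →L[𝕜] X)
    (hT : CMZE.ClosureGenerates L T) (hS : CMZE.ClosureGenerates (CMZE.leftComp Q L) S)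
    -- time differentiability of arbitrary order; from here on `L` is identified with its closure
    (hP : LinearMap.range (P : X →ₗ[𝕜] X) ≤ CMZE.smoothDomain L.closure)
    (hKdom : ∀ s : ℝ, 0 ≤ s → ∀ x : X,
      S s (Q (CMZE.powProj L.closure P hP 1 x)) ∈ L.closure.domain)
    (hKsmooth : ∀ x : X,
      ContDiffOn ℝ ∞ (fun s => CMZE.memoryKernel L.closure P Q hP S s x) (Ici 0))
    -- `a 1 = (P L P)|_V` is invertible, with inverse `R`
    (V : Submodule 𝕜 X) (hV : LinearMap.range (P : X →ₗ[𝕜] X) ≤ V)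
    (a : ℕ → Module.End 𝕜 V) (ha : a = CMZE.moment L.closure P hP V hV)
    (R : Module.End 𝕜 V) (hR : a 1 * R = 1) (hR' : R * a 1 = 1) :
    -- the differential form of Dyson's identity
    (∀ t : ℝ, 0 ≤ t → ∀ x : X,
      IntervalIntegrable
        (fun s => P (T (t - s) (CMZE.memoryKernel L.closure P Q hP S s x)))
        MeasureTheory.volume 0 t ∧
      HasDerivWithinAt (fun τ => P (T τ (P x)))
        (P (T t (P (CMZE.powProj L.closure P hP 1 x))) +
          ∫ s in (0 : ℝ)..t, P (T (t - s) (CMZE.memoryKernel L.closure P Q hP S s x)))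
        (Ici 0) t) ∧
    ∃ F : ℕ → Module.End 𝕜 V,
      -- the operators `F n` form the unique solution of the operator equations in `V`,
      (∀ G : ℕ → Module.End 𝕜 V, CMZE.SolvesWordEquation (𝕜 := 𝕜) a G ↔ G = F) ∧
      -- they are constructed recursively,
      F 0 = a 2 - a 1 ^ 2 ∧
      (∀ n : ℕ, 1 ≤ n → F n =
        CMZE.evalAt a (CMZE.bipartitionPoly 𝕜 (n + 2)) * R ^ n -
          ∑ k ∈ Finset.Icc 1 (n - 1), F k * CMZE.evalAt a (CMZE.bellPolyII 𝕜 n k) * R ^ n) ∧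
      -- and they are polynomials in the `a j`, `j ≥ 1`, and `(a 1)⁻¹`
      (∀ n : ℕ, F n ∈ Algebra.adjoin 𝕜 (insert R (a '' Ici 1))) ∧
      (∀ (n k : ℕ) (t : ℝ), 0 ≤ t → ∀ x : X,
        IntervalIntegrable (CMZE.termIntegrand T P V hV F n k t x) MeasureTheory.volume 0 t) ∧
      -- the expansion of the memory kernel, to all orders in time
      (∀ (N : ℕ) (x : X),
        (fun s : ℝ => CMZE.memoryKernel L.closure P Q hP S s x -
          ∑ n ∈ Finset.range (N + 1), ((n ! : 𝕜)⁻¹) •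
            ((F n (((CMZE.projEvolution T P V hV s - 1) ^ n) (CMZE.projVec P V hV x)) : V) : X))
          =O[𝓝[≥] 0] fun s : ℝ => s ^ (N + 1)) ∧
      -- the combinatorial expansion of Dyson's identity, to all orders in time
      (∀ (N : ℕ) (x : X),
        (fun t : ℝ => derivWithin (fun τ => P (T τ (P x))) (Ici 0) t -
          (P (T t (P (CMZE.powProj L.closure P hP 1 x))) +
            ∑ n ∈ Finset.range (N + 1), CMZE.memoryTerm T P V hV F n t x))
          =O[𝓝[≥] 0] fun t : ℝ => t ^ (N + 2)) ∧
      -- if the two operator families depend analytically on time, the series converges for small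
      -- times and the expansion is an identity there
      (∀ (δ : ℝ) (K : ℝ → X →L[𝕜] X), 0 < δ →
        (∀ s ∈ Ico 0 δ, ∀ x : X, K s x = CMZE.memoryKernel L.closure P Q hP S s x) →
        AnalyticOn ℝ K (Ico 0 δ) →
        AnalyticOn ℝ (fun s => P * T s * P) (Ico 0 δ) →
        ∃ τ : ℝ, 0 < τ ∧ τ ≤ δ ∧ ∀ t ∈ Ico 0 τ, ∀ x : X, ∃ M : X,
          HasSum (fun n => CMZE.memoryTerm T P V hV F n t x) M ∧
          HasDerivWithinAt (fun τ' => P (T τ' (P x)))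
            (P (T t (P (CMZE.powProj L.closure P hP 1 x))) + M) (Ici 0) t) ∧
      -- and it remains an identity as long as the series of operators converges normally
      (∀ (τ r ρ : ℝ) (K : ℝ → X →L[𝕜] X) (c : ℕ → ℝ), r < ρ →
        (∀ s ∈ Ico 0 τ, ∀ x : X, K s x = CMZE.memoryKernel L.closure P Q hP S s x) →
        AnalyticOn ℝ K (Ico 0 τ) →
        AnalyticOn ℝ (fun s => P * T s * P) (Ico 0 τ) →
        (∀ s ∈ Ico 0 τ, ∀ v : V, ‖CMZE.projEvolution T P V hV s v - v‖ ≤ r * ‖v‖) →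
        (∀ (n : ℕ) (v : V), ‖F n v‖ ≤ c n * ‖v‖) →
        Summable (fun n => c n * ρ ^ n / (n ! : ℝ)) →
        ∀ t ∈ Ico 0 τ, ∀ x : X, ∃ M : X,
          HasSum (fun n => CMZE.memoryTerm T P V hV F n t x) M ∧
          HasDerivWithinAt (fun τ' => P (T τ' (P x)))
            (P (T t (P (CMZE.powProj L.closure P hP 1 x))) + M) (Ici 0) t) := by
  have h : CMZE.ProjectedDynamics P Q L T S hP := ⟨hPQ, hPQ0, hT, hS, hKdom, hKsmooth⟩
  -- Surjectivity of `a 1`, whose values lie in `Ran P`, forces `V = Ran P`; hence `V` is the fixed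
  -- space of `P`, closed and complete.
  have hVP : ∀ v : V, P v = v := fun v => by
    have h1 : a 1 (R v) = v := DFunLike.congr_fun hR v
    have h2 : P (CMZE.powProj L.closure P hP 1 (R v)) = v := by
      have := congrArg Subtype.val h1
      rw [ha] at this
      exact this
    rw [← h2, h.proj_proj_apply]
  have hVclosed : IsClosed (V : Set X) := by
    have : (V : Set X) = {x | P x = x} := by
      ext x
      exact ⟨fun hx => hVP ⟨x, hx⟩, fun hx => hV ⟨x, hx⟩⟩
    rw [this]
    exact isClosed_eq P.continuous continuous_id
  have : CompleteSpace V := hVclosed.completeSpace_coe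
  have hac : ∀ j, Continuous (a j) := fun j => by
    rw [ha]
    exact CMZE.continuous_moment hT.isClosable.closure_isClosed P hP V hV j
  -- Bounded versions of `a` and `R`; the solution built from them maps to the algebraic one.
  let b : ℕ → V →L[𝕜] V := fun j => ⟨a j, hac j⟩
  let B : V →L[𝕜] V := ⟨R, CMZE.continuous_of_mul_eq_one (hac 1) hR hR'⟩
  have hb : ∀ j, CMZE.toEnd 𝕜 V (b j) = CMZE.moment L.closure P hP V hV j := fun j => by
    rw [← ha]; rfl
  have hbB : b 1 * B = 1 := ContinuousLinearMap.coe_injective hR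
  have hBb : B * b 1 = 1 := ContinuousLinearMap.coe_injective hR'
  have hF : CMZE.wordSolution 𝕜 a R = fun n => CMZE.toEnd 𝕜 V (CMZE.wordSolution 𝕜 b B n) := by
    funext n
    rw [CMZE.map_wordSolution]
    rfl
  refine ⟨fun t ht x => ⟨h.intervalIntegrable_map_convolution P ht
    (h.continuousOn_memoryKernel x), h.hasDerivWithinAt_proj x ht⟩,
    CMZE.wordSolution 𝕜 a R, fun G => CMZE.solvesWordEquation_iff_eq a R hR hR' G,
    CMZE.wordSolution_zero a R, fun n hn => CMZE.wordSolution_eq_sum_Icc a R n hn,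
    CMZE.wordSolution_mem a R, ?_, ?_, ?_, ?_, ?_⟩
  · intro n k t ht x
    rw [hF]
    exact h.intervalIntegrable_termIntegrand _ n k ht x
  · intro N x
    rw [hF]
    refine (h.isBigO_memoryKernel_sub_sum hVP hb hbB hBb N x).congr_left fun s => ?_
    congr 1
    refine Finset.sum_congr rfl fun n _ => ?_
    rw [← CMZE.toEnd_evolution, ← map_one (CMZE.toEnd 𝕜 V), ← map_sub, ← map_pow]
    rfl
  · intro N x
    rw [hF]
    exact h.isBigO_deriv_sub_sum hVP hb hbB hBb N x
  · intro δ K hδ hKI hK hTa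
    obtain ⟨C, M, hC, hM, hCM⟩ := h.geomBounded_wordSolution hVP hb hbB hBb hδ hKI hK hTa
    have hM0 : 0 < M := one_pos.trans_le hM
    -- Any `ρ < 1 / M` would do; `1 / (2 * M)` gives a series of ratio `1 / 2`, and `1 / (4 * M)`
    -- then serves as `r`.
    have hsum : Summable fun n => ‖((n ! : 𝕜)⁻¹) • CMZE.wordSolution 𝕜 b B n‖ *
        (1 / (2 * M)) ^ n := by
      refine Summable.of_nonneg_of_le (fun n => by positivity) (fun n => ?_)
        ((summable_geometric_of_lt_one (r := (1 / 2 : ℝ)) (by norm_num) (by norm_num)).mul_left C)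
      calc _ ≤ C * M ^ n * (1 / (2 * M)) ^ n := by gcongr; exact hCM n
        _ = C * (1 / 2) ^ n := by
          rw [mul_assoc, ← mul_pow]
          congr 2
          field_simp
    have hr : 1 / (4 * M) < 1 / (2 * M) :=
      one_div_lt_one_div_of_lt (by positivity) (by linarith)
    have hev : ∀ᶠ s in 𝓝[≥] 0, ‖CMZE.evolution T P V hV s - 1‖ ≤ 1 / (4 * M) := by
      have := (h.tendsto_evolution_sub_one hVP hb hδ (h.analyticOn_evolution hTa)).norm
      rw [norm_zero] at this
      exact this.eventually_le_const (by positivity)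
    obtain ⟨ε, hε, hsub⟩ := mem_nhdsGE_iff_exists_Ico_subset.1 hev
    have hI : Ico 0 (min ε δ) ⊆ Ico 0 δ := Ico_subset_Ico_right (min_le_right _ _)
    refine ⟨min ε δ, lt_min hε hδ, min_le_right _ _, fun t ht x => ⟨_, ?_,
      h.hasDerivWithinAt_proj x ht.1⟩⟩
    rw [hF]
    exact h.hasSum_memoryTerm hVP hb hbB hBb (by positivity) hr hsum
      (fun s hs => hKI s (hI hs)) (hK.mono hI) (hTa.mono hI)
      (fun s hs => hsub ⟨hs.1, hs.2.trans_le (min_le_left _ _)⟩) ht x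
  · intro τ r ρ K c hrρ hKI hK hTa hE hc hsum t ht x
    refine ⟨_, ?_, h.hasDerivWithinAt_proj x ht.1⟩
    rw [hF] at hc ⊢
    -- If `V` is trivial, the bounds do not force `r` or `c n` to be nonnegative. All operators on
    -- `V` then vanish, so `r = 0` and `ρ = 1` serve instead.
    rcases subsingleton_or_nontrivial V with hV0 | hV1
    · exact h.hasSum_memoryTerm hVP hb hbB hBb le_rfl one_pos (by
        simp [ContinuousLinearMap.opNorm_subsingleton]) hKI hK hTa (fun s _ => by
        rw [ContinuousLinearMap.opNorm_subsingleton]) ht x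
    · obtain ⟨v, hv⟩ := exists_ne (0 : V)
      have hv0 : 0 < ‖v‖ := norm_pos_iff.2 hv
      have hr0 : 0 ≤ r := nonneg_of_mul_nonneg_left ((norm_nonneg _).trans (hE t ht v)) hv0
      have hc0 : ∀ n, 0 ≤ c n := fun n =>
        nonneg_of_mul_nonneg_left ((norm_nonneg _).trans (hc n v)) hv0
      refine h.hasSum_memoryTerm hVP hb hbB hBb hr0 hrρ ?_ hKI hK hTa (fun s hs => ?_) ht x
      · have hρ : 0 ≤ ρ := hr0.trans hrρ.le
        refine Summable.of_nonneg_of_le (fun n => by positivity) (fun n => ?_) hsum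
        have hn : ‖CMZE.wordSolution 𝕜 b B n‖ ≤ c n :=
          ContinuousLinearMap.opNorm_le_bound _ (hc0 n) (hc n)
        rw [norm_smul, norm_inv, RCLike.norm_natCast]
        calc _ ≤ ((n ! : ℝ))⁻¹ * c n * ρ ^ n := by gcongr
          _ = _ := by ring
      · exact ContinuousLinearMap.opNorm_le_bound _ hr0 (hE s hs)
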